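/- Let $H,U$ be real Hilbert spaces, $0<\alpha\le 1$, $n\ge 1$, and $0=t_0<t_1<\dots<t_n\le t_{n+1}=b$. Let $A$ generate a $C_0$-semigroup $(S(t))_{t\ge0}$ on $H$, let $B\in\mathcal L(U,H)$, $D_k\in\mathcal L(H)$, $E_k\in\mathcal L(U,H)$ ($1\le k\le n$), and consider the impulsive control system $$ {}^{C}D^{\alpha}_{t_k^+}x(t)=Ax(t)+Bu(t)\ \ (t\in[0,b]\setminus\{t_1,\dots,t_n\}),\qquad \Delta x(t_k)=D_kx(t_k)+E_kv_k\ \ (1\le k\le n),\qquad x(0)=x_0, $$ with controls $u\in L^2([0,b],U)$ and $v=(v_1,\dots,v_n)\in U^n$. With the Wright function $\Psi_\alpha(\theta)=\sum_{m\ge0}\frac{(-\theta)^m}{m!\,\Gamma(-\alpha m+1-\alpha)}$ put, for $0<\alpha<1$ and $t\ge 0$, $$\mathcal S_\alpha(t)=\int_0^\infty\Psi_\alpha(\theta)S(t^\alpha\theta)\,d\theta,\qquad \mathcal P_\alpha(t)=\int_0^\infty\alpha\theta\,\Psi_\alpha(\theta)S(t^\alpha\theta)\,d\theta$$ (strong integrals),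 and $\mathcal S_1(t)=\mathcal P_1(t)=S(t)$. Write $\mathcal S=\mathcal S_\alpha(b-t_n)$ and $X_j=(I+D_j)\mathcal S_\alpha(t_j-t_{j-1})$, so that $X_j^*=\mathcal S_\alpha^*(t_j-t_{j-1})(I+D_j^*)$; let $\prod_{j=n}^{i}X_j=X_nX_{n-1}\cdots X_i$ and $\prod_{j=i}^{n}X_j^*=X_i^*\cdots X_n^*$, empty products being $I$. Define $\mathcal M:L^2([0,b],U)\times U^n\to H$ by $$\begin{aligned}\mathcal M(u,v)={}&\int_{t_n}^b(b-s)^{\alpha-1}\mathcal P_\alpha(b-s)Bu(s)\,ds+\mathcal S\sum_{i=1}^n\prod_{j=n}^{i+1}X_j\,(I+D_i)\int_{t_{i-1}}^{t_i}(t_i-s)^{\alpha-1}\mathcal P_\alpha(t_i-s)Bu(s)\,ds\\&+\mathcal S\sum_{i=2}^n\prod_{j=n}^{i}X_j\,E_{i-1}v_{i-1}+\mathcal S E_nv_n;\end{aligned}$$ the system is called approximately controllable on $[0,b]$ if $\overline{\operatorname{Im}\mathcal M}=H$. Define the maps $H\to H$ $$\Omega_{t_n}^b\varphi=\int_{t_n}^b(b-s)^{2\alpha-2}\mathcal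 P_\alpha(b-s)BB^*\mathcal P_\alpha^*(b-s)\varphi\,ds,\qquad \tilde\Omega_{t_n}^b\varphi=\mathcal S E_nE_n^*\mathcal S^*\varphi,$$ $$\Psi_0^{t_n}\varphi=\mathcal S\sum_{i=1}^n\prod_{j=n}^{i+1}X_j\,(I+D_i)\int_{t_{i-1}}^{t_i}(t_i-s)^{2\alpha-2}\mathcal P_\alpha(t_i-s)BB^*\mathcal P_\alpha^*(t_i-s)(I+D_i^*)\prod_{j=i+1}^nX_j^*\,\mathcal S^*\varphi\,ds,$$ $$\tilde\Psi_0^{t_n}\varphi=\mathcal S\sum_{i=2}^n\prod_{j=n}^{i}X_j\,E_{i-1}E_{i-1}^*\prod_{j=i}^nX_j^*\,\mathcal S^*\varphi .$$ For $\alpha>\tfrac12$ all integrals over subintervals of $[0,b]$ above converge; for $\alpha\le\tfrac12$ such an integral is read as $0$ where it diverges. Call a map $T:H\to H$ non-negative if $\langle Ty,y\rangle\ge0$ for all $y$, and strictly positive if $\langle Ty,y\rangle>0$ for all $y\ne0$. Then $\Omega_{t_n}^b,\Psi_0^{t_n},\tilde\Omega_{t_n}^b,\tilde\Psi_0^{t_n}$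 are non-negative, and if at least one of them is strictly positive, then $\Omega_{t_n}^b+\Psi_0^{t_n}+\tilde\Omega_{t_n}^b+\tilde\Psi_0^{t_n}$ is strictly positive and the system is approximately controllable on $[0,b]$. -/

import Mathlib

open MeasureTheory Filter Topology
open scoped InnerProductSpace

noncomputable section

namespace FracImpulsive

/-! ### Semigroups and strong operator integrals -/

/-- A strongly continuous semigroup of bounded operators on `H`, indexed by `t ≥ 0`
(the values at negative `t` carry no condition and are never used). -/
structure C0Semigroup (H : Type*) [NormedAddCommGroup H] [NormedSpace ℝ H] where
  toFun : ℝ → H →L[ℝ] H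
  map_zero : toFun 0 = 1
  map_add : ∀ s t : ℝ, 0 ≤ s → 0 ≤ t → toFun (s + t) = toFun s * toFun t
  tendsto_zero : ∀ x : H, Tendsto (fun t => toFun t x) (𝓝[>] 0) (𝓝 x)

/-- `A` (with its domain) is the infinitesimal generator of `S`: `x ∈ D(A)` and `A x = y` exactly
when `(S(t) x - x) / t → y` as `t → 0+`. -/
def IsGenerator {H : Type*} [NormedAddCommGroup H] [NormedSpace ℝ H]
    (A : H →ₗ.[ℝ] H) (S : C0Semigroup H) : Prop :=
  ∀ x y : H, (x, y) ∈ A.graph ↔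
    Tendsto (fun t : ℝ => t⁻¹ • (S.toFun t x - x)) (𝓝[>] 0) (𝓝 y)

section StrongIntegral

variable {H : Type*} [NormedAddCommGroup H] [NormedSpace ℝ H]

/-- `x ↦ ∫ F(θ) x dμ(θ)` as a linear map, when all these integrals converge. -/
def strongIntegralLinear (F : ℝ → H →L[ℝ] H) (μ : Measure ℝ)
    (h : ∀ x, Integrable (fun θ => F θ x) μ) : H →ₗ[ℝ] H where
  toFun x := ∫ θ, F θ x ∂μ
  map_add' x y := by
    simp only [_root_.map_add]
    exact integral_add (h x) (h y)
  map_smul' c x := by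
    simp only [map_smul, RingHom.id_apply]
    exact integral_smul c _

theorem strongIntegralLinear_continuous [CompleteSpace H] (F : ℝ → H →L[ℝ] H) (μ : Measure ℝ)
    (h : ∀ x, Integrable (fun θ => F θ x) μ) : Continuous (strongIntegralLinear F μ h) := by
  let L : H →ₗ[ℝ] (ℝ →₁[μ] H) :=
    { toFun := fun x => (h x).toL1 _
      map_add' := fun x y => by
        rw [← Integrable.toL1_add]
        congr 1
        ext θ
        simp
      map_smul' := fun c x => by
        rw [RingHom.id_apply, ← Integrable.toL1_smul]
        congr 1
        ext θ
        simp }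
  have hL : Continuous L := by
    refine L.continuous_of_seq_closed_graph ?_
    intro u x y hu hy
    have hm : TendstoInMeasure μ (fun n => ((L (u n) : ℝ →₁[μ] H) : ℝ → H)) atTop y :=
      tendstoInMeasure_of_tendsto_Lp hy
    obtain ⟨ns, hns, hae⟩ := hm.exists_seq_tendsto_ae
    have h1 : ∀ᵐ θ ∂μ, ∀ n, (L (u n) : ℝ → H) θ = F θ (u n) :=
      ae_all_iff.2 fun n => (h (u n)).coeFn_toL1
    have h2 : ∀ᵐ θ ∂μ, (L x : ℝ → H) θ = F θ x := (h x).coeFn_toL1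
    refine Lp.ext ?_
    filter_upwards [hae, h1, h2] with θ e0 e1 e2
    rw [e2]
    refine tendsto_nhds_unique e0 ?_
    simp only [e1]
    exact ((F θ).continuous.tendsto x).comp (hu.comp hns.tendsto_atTop)
  have : (strongIntegralLinear F μ h : H → H) = fun x => ∫ θ, (L x : ℝ → H) θ ∂μ := by
    funext x
    exact (integral_congr_ae (h x).coeFn_toL1).symm
  rw [this]
  exact continuous_integral.comp hL

open Classical in
/-- The bounded operator `∫ F(θ) dμ(θ)`, the integral being taken in the strong sense. -/
def strongIntegral [CompleteSpace H] (F : ℝ → H →L[ℝ] H) (μ : Measure ℝ) : H →L[ℝ] H :=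
  if h : ∀ x, Integrable (fun θ => F θ x) μ then
    ⟨strongIntegralLinear F μ h, strongIntegralLinear_continuous F μ h⟩
  else 0

theorem strongIntegral_apply [CompleteSpace H] (F : ℝ → H →L[ℝ] H) (μ : Measure ℝ)
    (h : ∀ x, Integrable (fun θ => F θ x) μ) (x : H) :
    strongIntegral F μ x = ∫ θ, F θ x ∂μ := by
  rw [strongIntegral, dif_pos h]
  rfl

end StrongIntegral

/-! ### The Wright function and the fractional solution operators -/

/-- The Wright function `Ψ_α(θ) = ∑ (-θ)^m / (m! Γ(-α m + 1 - α))`. The value of `Real.Gamma` at a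
pole is `0`, so the corresponding summand is `0`, which is the usual reading of `1 / Γ` there. -/
def wright (α θ : ℝ) : ℝ :=
  ∑' m : ℕ, (-θ) ^ m / ((m.factorial : ℝ) * Real.Gamma (-α * m + 1 - α))

section SolutionOperators

variable {H : Type*} [NormedAddCommGroup H] [NormedSpace ℝ H] [CompleteSpace H]

/-- `𝒮_α(t) = ∫_0^∞ Ψ_α(θ) S(t^α θ) dθ` for `0 < α < 1`. For `α = 1` the measure `Ψ_α(θ) dθ`
degenerates to the unit mass at `θ = 1`, and `𝒮_1(t) = S(t)`. -/
def fracS (S : C0Semigroup H) (α t : ℝ) : H →L[ℝ] H :=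
  if α = 1 then S.toFun t
  else strongIntegral (fun θ => wright α θ • S.toFun (t ^ α * θ)) (volume.restrict (Set.Ioi 0))

/-- `𝒫_α(t) = ∫_0^∞ α θ Ψ_α(θ) S(t^α θ) dθ` for `0 < α < 1`, and `𝒫_1(t) = S(t)`. -/
def fracP (S : C0Semigroup H) (α t : ℝ) : H →L[ℝ] H :=
  if α = 1 then S.toFun t
  else strongIntegral (fun θ => (α * θ * wright α θ) • S.toFun (t ^ α * θ))
    (volume.restrict (Set.Ioi 0))

end SolutionOperators

/-! ### Ordered products -/

section Products

variable {R : Type*} [Monoid R]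

/-- `∏_{j=k}^{i} X_j = X_k X_{k-1} ⋯ X_i`, equal to `1` when `k < i`. -/
def descProd (X : ℕ → R) (k i : ℕ) : R :=
  ((List.range' i (k + 1 - i)).reverse.map X).prod

/-- `∏_{j=i}^{k} X_j = X_i X_{i+1} ⋯ X_k`, equal to `1` when `k < i`. -/
def ascProd (X : ℕ → R) (i k : ℕ) : R :=
  ((List.range' i (k + 1 - i)).map X).prod

end Products

/-! ### The impulsive control system -/

/-- The data of the linear fractional impulsive control system
`ᶜD^α x = A x + B u` on `[0, b] \ {t_1, …, t_n}`, `Δx(t_k) = D_k x(t_k) + E_k v_k`, `k = 1, …, n`,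
with `0 = t_0 < t_1 < ⋯ < t_n ≤ t_{n+1} = b` and `A` the generator of a `C_0`-semigroup `S`.
Only the entries `D k`, `E k` with `1 ≤ k ≤ n` and `t k` with `k ≤ n + 1` are used. -/
structure System (H U : Type*) [NormedAddCommGroup H] [InnerProductSpace ℝ H]
    [NormedAddCommGroup U] [InnerProductSpace ℝ U] where
  α : ℝ
  α_pos : 0 < α
  α_le_one : α ≤ 1
  b : ℝ
  n : ℕ
  one_le_n : 1 ≤ n
  t : ℕ → ℝ
  t_zero : t 0 = 0
  t_lt : ∀ k < n, t k < t (k + 1)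
  t_n_le : t n ≤ b
  t_last : t (n + 1) = b
  A : H →ₗ.[ℝ] H
  S : C0Semigroup H
  generator : IsGenerator A S
  B : U →L[ℝ] H
  D : ℕ → H →L[ℝ] H
  E : ℕ → U →L[ℝ] H

namespace System

open ContinuousLinearMap (adjoint)

variable {H U : Type*} [NormedAddCommGroup H] [InnerProductSpace ℝ H] [CompleteSpace H]
  [NormedAddCommGroup U] [InnerProductSpace ℝ U] [CompleteSpace U]

/-- `𝒮_α(τ)` for the semigroup and the order of the system. -/
def Sα (Q : System H U) (τ : ℝ) : H →L[ℝ] H := fracS Q.S Q.α τ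

/-- `𝒫_α(τ)` for the semigroup and the order of the system. -/
def Pα (Q : System H U) (τ : ℝ) : H →L[ℝ] H := fracP Q.S Q.α τ

/-- `(I + D_j) 𝒮_α(t_j - t_{j-1})`. -/
def step (Q : System H U) (j : ℕ) : H →L[ℝ] H :=
  (1 + Q.D j) * Q.Sα (Q.t j - Q.t (j - 1))

/-- `𝒮_α^*(t_j - t_{j-1}) (I + D_j^*)`. -/
def stepAdj (Q : System H U) (j : ℕ) : H →L[ℝ] H :=
  adjoint (Q.Sα (Q.t j - Q.t (j - 1))) * (1 + adjoint (Q.D j))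

/-- The distributed controls, `L²([0, b], U)`. -/
abbrev ControlL2 (Q : System H U) : Type _ :=
  Lp U 2 (volume.restrict (Set.Icc 0 Q.b))

/-- The impulsive control `v_k`, `1 ≤ k ≤ n`, of a family `v = (v_1, …, v_n) ∈ Uⁿ`. -/
def impulse (Q : System H U) (v : Fin Q.n → U) (k : ℕ) : U :=
  if h : 1 ≤ k ∧ k ≤ Q.n then v ⟨k - 1, by omega⟩ else 0

/-- The control-to-final-state operator `ℳ : L²([0, b], U) × Uⁿ → H`. -/
def controlMap (Q : System H U) (c : Q.ControlL2 × (Fin Q.n → U)) : H :=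
  (∫ s in Q.t Q.n..Q.b,
      (Q.b - s) ^ (Q.α - 1) • Q.Pα (Q.b - s) (Q.B (c.1 s)))
  + Q.Sα (Q.b - Q.t Q.n) (∑ i ∈ Finset.Icc 1 Q.n,
      descProd Q.step Q.n (i + 1) ((1 + Q.D i)
        (∫ s in Q.t (i - 1)..Q.t i,
          (Q.t i - s) ^ (Q.α - 1) • Q.Pα (Q.t i - s) (Q.B (c.1 s)))))
  + Q.Sα (Q.b - Q.t Q.n) (∑ i ∈ Finset.Icc 2 Q.n,
      descProd Q.step Q.n i (Q.E (i - 1) (Q.impulse c.2 (i - 1))))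
  + Q.Sα (Q.b - Q.t Q.n) (Q.E Q.n (Q.impulse c.2 Q.n))

/-- Approximate controllability on `[0, b]`: the image of `ℳ` is dense in `H`. -/
def ApproximatelyControllable (Q : System H U) : Prop :=
  closure (Set.range Q.controlMap) = Set.univ

/-- `Ω_{t_n}^b`. -/
def gramΩ (Q : System H U) (φ : H) : H :=
  ∫ s in Q.t Q.n..Q.b, (Q.b - s) ^ (2 * Q.α - 2) •
    Q.Pα (Q.b - s) (Q.B (adjoint Q.B (adjoint (Q.Pα (Q.b - s)) φ)))

/-- `Ψ_0^{t_n}`. -/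
def gramΨ (Q : System H U) (φ : H) : H :=
  Q.Sα (Q.b - Q.t Q.n) (∑ i ∈ Finset.Icc 1 Q.n,
    descProd Q.step Q.n (i + 1) ((1 + Q.D i)
      (∫ s in Q.t (i - 1)..Q.t i, (Q.t i - s) ^ (2 * Q.α - 2) •
        Q.Pα (Q.t i - s) (Q.B (adjoint Q.B (adjoint (Q.Pα (Q.t i - s))
          ((1 + adjoint (Q.D i)) (ascProd Q.stepAdj (i + 1) Q.n
            (adjoint (Q.Sα (Q.b - Q.t Q.n)) φ)))))))))

/-- `Ω̃_{t_n}^b`. -/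
def gramΩtilde (Q : System H U) (φ : H) : H :=
  Q.Sα (Q.b - Q.t Q.n) (Q.E Q.n (adjoint (Q.E Q.n)
    (adjoint (Q.Sα (Q.b - Q.t Q.n)) φ)))

/-- `Ψ̃_0^{t_n}`. -/
def gramΨtilde (Q : System H U) (φ : H) : H :=
  Q.Sα (Q.b - Q.t Q.n) (∑ i ∈ Finset.Icc 2 Q.n,
    descProd Q.step Q.n i (Q.E (i - 1) (adjoint (Q.E (i - 1))
      (ascProd Q.stepAdj i Q.n (adjoint (Q.Sα (Q.b - Q.t Q.n)) φ)))))

end System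

/-! ### Positivity -/

section Positivity

variable {H : Type*} [NormedAddCommGroup H] [InnerProductSpace ℝ H]

/-- `⟨T y, y⟩ ≥ 0` for all `y`. -/
def IsPositiveMap (T : H → H) : Prop := ∀ y : H, 0 ≤ ⟪T y, y⟫_ℝ

/-- `⟨T y, y⟩ > 0` for all `y ≠ 0`. -/
def IsStrictlyPositiveMap (T : H → H) : Prop := ∀ y : H, y ≠ 0 → 0 < ⟪T y, y⟫_ℝ

end Positivity

end FracImpulsive

end

/-!
The Gramians are built so that `⟪Ω y, y⟫`, `⟪Ψ y, y⟫`, `⟪Ω̃ y, y⟫` and `⟪Ψ̃ y, y⟫` are sums and integrals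
of the squares `‖B^* 𝒫_α^*(t_j - s) z_j‖²` and `‖E_k^* ⋯ 𝒮^* y‖²`, where `z_j` (`System.costate`) is
`y` transported backwards by the adjoint evolution to the right end point of the `j`-th
subinterval. Hence all four are non-negative, and their sum is strictly positive as soon as one of
them is.

For approximate controllability one has to show that a vector `y` orthogonal to the reachable states
is zero, and by strict positivity it is enough that all four squares vanish for it. For the impulsive
part, `Ω̃ y + Ψ̃ y` is itself a value of the control map. For the distributed part, the Gramian need
not be a value of the control map when `α ≤ 1 / 2`, because `(t_j - s) ^ (2 α - 2)` is then not
integrable, and the control map need not even be linear, as divergent integrals are read as `0`.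
Therefore only controls for which all integrals converge are used; on these the control map is
linear (`System.admissibleImage`). Testing `y` with the bounded control
`s ↦ ⟪𝒫_α(t_j - s) B w, z_j⟫ w`, supported on one subinterval, gives
`∫ (t_j - s) ^ (α - 1) ⟪𝒫_α(t_j - s) B w, z_j⟫² ds = 0`, so that `B^* 𝒫_α^*(t_j - s) z_j = 0` on the
whole subinterval (`System.observation_eq_zero`).

This test needs the strong continuity of `𝒫_α` on `[0, ∞)` (`continuousOn_fracP_apply`), which follows
by dominated convergence from the exponential growth bound of the semigroup and from the
fact that the Wright function decays faster than every exponential (`exists_abs_wright_le`). For the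
latter, summing the defining series by means of Euler's integral shows that `π Ψ_α(θ)` is the
imaginary part of the integral of `exp (z - θ z ^ α) z ^ (α - 1)` along a ray from `0` into the left half
plane. Sliding the vertex of the ray along the positive real axis changes this integral by a real
number only, and once the vertex is at `R > 0`, the real part of `z ^ α` is at least a multiple
of `R ^ α` on the ray, which produces the factor `exp (- c R ^ α θ)` with `R` arbitrary.
-/

namespace FracImpulsive

/-! ### The Hankel kernel of the Wright function on a ray -/

/-- The point at distance `r` from `R` on the ray of direction `exp (i ψ)`. -/
noncomputable def rayPoint (ψ R r : ℝ) : ℂ := R + r * Complex.exp (ψ * Complex.I)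

/-- The integrand `exp (z - θ z ^ α) z ^ (α - 1)` of the Hankel representation of the Wright
function. -/
noncomputable def hankelKernel (α θ : ℝ) (z : ℂ) : ℂ :=
  Complex.exp (z - θ * z ^ (α : ℂ)) * z ^ ((α - 1 : ℝ) : ℂ)

/-- The derivative of `hankelKernel`. -/
noncomputable def hankelKernelDeriv (α θ : ℝ) (z : ℂ) : ℂ :=
  Complex.exp (z - θ * z ^ (α : ℂ)) * ((1 - θ * (α * z ^ ((α - 1 : ℝ) : ℂ))) * z ^ ((α - 1 : ℝ) : ℂ)
    + ((α - 1 : ℝ) : ℂ) * z ^ ((α - 2 : ℝ) : ℂ))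

/-- The integral of the Hankel kernel along the ray of direction `exp (i ψ)` issuing from `R`. -/
noncomputable def hankelRay (α ψ θ R : ℝ) : ℂ :=
  ∫ r in Set.Ioi (0 : ℝ), hankelKernel α θ (rayPoint ψ R r) * Complex.exp (ψ * Complex.I)

theorem rayPoint_re (ψ R r : ℝ) : (rayPoint ψ R r).re = R + r * Real.cos ψ := by
  simp [rayPoint, Complex.exp_ofReal_mul_I_re]

theorem rayPoint_im (ψ R r : ℝ) : (rayPoint ψ R r).im = r * Real.sin ψ := by
  simp [rayPoint, Complex.exp_ofReal_mul_I_im]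

section Ray

variable {α ψ θ R r : ℝ}

theorem rayPoint_mem_slitPlane (hψ : 0 < Real.sin ψ) (hr : 0 ≤ r)
    (h : 0 < R ∨ 0 < r) : rayPoint ψ R r ∈ Complex.slitPlane := by
  rw [Complex.mem_slitPlane_iff, rayPoint_re, rayPoint_im]
  rcases hr.eq_or_lt with rfl | hr
  · left; rcases h with h | h
    · simpa using h
    · exact absurd h (lt_irrefl _)
  · right; positivity

theorem dist_origin_le_norm_rayPoint :
    r * Real.sin ψ ≤ ‖rayPoint ψ R r‖ := by
  rw [← rayPoint_im ψ R r]
  exact (le_abs_self _).trans (Complex.abs_im_le_norm _)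

theorem vertex_le_norm_rayPoint : R * Real.sin ψ ≤ ‖rayPoint ψ R r‖ := by
  have h := Complex.sq_norm (rayPoint ψ R r)
  rw [Complex.normSq_apply, rayPoint_re, rayPoint_im] at h
  refine le_of_sq_le_sq ?_ (norm_nonneg _)
  rw [h]
  have : (R + r * Real.cos ψ) * (R + r * Real.cos ψ) + r * Real.sin ψ * (r * Real.sin ψ) =
      (R * Real.sin ψ) ^ 2 + (R * Real.cos ψ + r) ^ 2 := by
    linear_combination (r ^ 2 - R ^ 2) * Real.sin_sq_add_cos_sq ψ
  rw [this]
  exact le_add_of_nonneg_right (sq_nonneg _)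

/-- Points of the ray have argument in `[0, ψ]`, hence their `α`-th powers have argument in
`[0, α ψ]`. -/
theorem le_re_rayPoint_cpow (hα : 0 < α) (hψ : 0 < Real.sin ψ) (hψ0 : 0 ≤ ψ) (hψπ : ψ ≤ Real.pi)
    (hαψ : α * ψ ≤ Real.pi) (hR : 0 ≤ R) (hr : 0 ≤ r) (h : 0 < R ∨ 0 < r) :
    ‖rayPoint ψ R r‖ ^ α * Real.cos (α * ψ) ≤ (rayPoint ψ R r ^ (α : ℂ)).re := by
  set z := rayPoint ψ R r with hz
  have hz0 : z ≠ 0 := Complex.slitPlane_ne_zero (rayPoint_mem_slitPlane hψ hr h)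
  have harg0 : 0 ≤ z.arg := by
    rw [Complex.arg_nonneg_iff, hz, rayPoint_im]; positivity
  have harg : z.arg ≤ ψ := by
    by_contra! hlt
    have hs : 0 < Real.sin (z.arg - ψ) :=
      Real.sin_pos_of_pos_of_lt_pi (by linarith) (by
        have := Complex.arg_le_pi z
        rcases hψ0.eq_or_lt with rfl | h0
        · simp at hψ
        · linarith)
    have h1 : ‖z‖ * Real.sin (z.arg - ψ) = - (R * Real.sin ψ) := by
      rw [Real.sin_sub, mul_sub, ← mul_assoc, ← mul_assoc, Complex.norm_mul_sin_arg,
        Complex.norm_mul_cos_arg, hz, rayPoint_re, rayPoint_im]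
      ring
    have h2 : 0 < ‖z‖ * Real.sin (z.arg - ψ) := mul_pos (norm_pos_iff.2 hz0) hs
    have h3 : 0 ≤ R * Real.sin ψ := by positivity
    linarith
  have hre : (z ^ (α : ℂ)).re = ‖z‖ ^ α * Real.cos (α * z.arg) := by
    rw [Complex.cpow_ofReal_re, mul_comm α]
  rw [hre]
  refine mul_le_mul_of_nonneg_left ?_ (by positivity)
  exact Real.cos_le_cos_of_nonneg_of_le_pi (by positivity) hαψ
    (mul_le_mul_of_nonneg_left harg hα.le)

theorem norm_exp_rayPoint_le (hα : 0 < α) (hθ : 0 ≤ θ) (hψ : 0 < Real.sin ψ) (hψ0 : 0 ≤ ψ)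
    (hψπ : ψ ≤ Real.pi) (hαψ : α * ψ ≤ Real.pi / 2) (hR : 0 ≤ R) (hr : 0 ≤ r)
    (h : 0 < R ∨ 0 < r) :
    ‖Complex.exp (rayPoint ψ R r - θ * rayPoint ψ R r ^ (α : ℂ))‖ ≤
      Real.exp (r * Real.cos ψ) *
        (Real.exp R * Real.exp (-(θ * (Real.cos (α * ψ) * (R * Real.sin ψ) ^ α)))) := by
  rw [Complex.norm_exp, ← Real.exp_add, ← Real.exp_add, Real.exp_le_exp, Complex.sub_re,
    Complex.re_ofReal_mul, rayPoint_re]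
  have h1 := le_re_rayPoint_cpow (α := α) hα hψ hψ0 hψπ
    (by linarith [Real.pi_pos]) hR hr h
  have hc : 0 ≤ Real.cos (α * ψ) :=
    Real.cos_nonneg_of_neg_pi_div_two_le_of_le (by nlinarith [Real.pi_pos]) hαψ
  have h2 : (R * Real.sin ψ) ^ α ≤ ‖rayPoint ψ R r‖ ^ α :=
    Real.rpow_le_rpow (by positivity) vertex_le_norm_rayPoint hα.le
  have h3 := mul_le_mul_of_nonneg_left h2 hc
  have h4 : Real.cos (α * ψ) * (R * Real.sin ψ) ^ α ≤ (rayPoint ψ R r ^ (α : ℂ)).re := by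
    linarith
  nlinarith [mul_le_mul_of_nonneg_left h4 hθ]

theorem norm_hankelKernel_rayPoint_le (hα : 0 < α) (hα1 : α ≤ 1) (hθ : 0 ≤ θ)
    (hψ : 0 < Real.sin ψ) (hψ0 : 0 ≤ ψ)
    (hψπ : ψ ≤ Real.pi) (hαψ : α * ψ ≤ Real.pi / 2) (hR : 0 ≤ R) (hr : 0 < r) :
    ‖hankelKernel α θ (rayPoint ψ R r)‖ ≤
      r ^ (α - 1) * Real.exp (r * Real.cos ψ) * (Real.sin ψ ^ (α - 1) *
        (Real.exp R * Real.exp (-(θ * (Real.cos (α * ψ) * (R * Real.sin ψ) ^ α))))) := by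
  rw [hankelKernel, norm_mul, Complex.norm_cpow_real]
  have h1 := norm_exp_rayPoint_le (R := R) (r := r) hα hθ hψ hψ0 hψπ hαψ hR hr.le (Or.inr hr)
  have h2 : ‖rayPoint ψ R r‖ ^ (α - 1) ≤ (r * Real.sin ψ) ^ (α - 1) :=
    Real.rpow_le_rpow_of_nonpos (by positivity) dist_origin_le_norm_rayPoint
      (by linarith)
  refine (mul_le_mul h1 h2 (by positivity) (by positivity)).trans (le_of_eq ?_)
  rw [Real.mul_rpow hr.le hψ.le]
  ring

theorem hasDerivAt_hankelKernel {z : ℂ} (hz : z ∈ Complex.slitPlane) :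
    HasDerivAt (hankelKernel α θ) (hankelKernelDeriv α θ z) z := by
  have h1 := (hasDerivAt_id z).cpow_const (c := (α : ℂ)) hz
  have h2 := (hasDerivAt_id z).cpow_const (c := ((α - 1 : ℝ) : ℂ)) hz
  have h3 := (((hasDerivAt_id z).sub (h1.const_mul (θ : ℂ))).cexp).mul h2
  refine h3.congr_deriv ?_
  simp only [hankelKernelDeriv, id]
  have e1 : ((α : ℂ) - 1) = ((α - 1 : ℝ) : ℂ) := by push_cast; ring
  have e2 : (((α - 1 : ℝ) : ℂ) - 1) = ((α - 2 : ℝ) : ℂ) := by push_cast; ring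
  rw [e1, e2]
  simp only [Pi.sub_apply, id]
  ring

theorem hasDerivAt_rayPoint_left :
    HasDerivAt (fun R : ℝ => rayPoint ψ R r) 1 R := by
  unfold rayPoint
  exact (Complex.ofRealCLM.hasDerivAt (x := R)).add_const _

theorem hasDerivAt_rayPoint_right :
    HasDerivAt (fun r : ℝ => rayPoint ψ R r) (Complex.exp (ψ * Complex.I)) r := by
  unfold rayPoint
  have := ((Complex.ofRealCLM.hasDerivAt (x := r)).mul_const
    (Complex.exp (ψ * Complex.I))).const_add (R : ℂ)
  simpa using this

theorem integrableOn_rpow_mul_exp_mul {s c : ℝ} (hs : -1 < s) (hc : c < 0) :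
    IntegrableOn (fun r : ℝ => r ^ s * Real.exp (r * c)) (Set.Ioi 0) := by
  have := integrableOn_rpow_mul_exp_neg_mul_rpow (p := 1) (b := -c) hs one_pos (by linarith)
  refine this.congr_fun (fun x _ => ?_) measurableSet_Ioi
  simp [mul_comm]

theorem continuousOn_hankelKernel_rayPoint (hψ : 0 < Real.sin ψ) :
    ContinuousOn (fun r => hankelKernel α θ (rayPoint ψ R r)) (Set.Ioi 0) := fun _ hr =>
  ((hasDerivAt_hankelKernel (rayPoint_mem_slitPlane hψ (le_of_lt hr)
    (Or.inr hr))).continuousAt.comp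
    (f := fun r => rayPoint ψ R r) hasDerivAt_rayPoint_right.continuousAt).continuousWithinAt

theorem norm_hankelKernelDeriv_le (hα : 0 < α) (hα1 : α ≤ 1) (hθ : 0 ≤ θ)
    (hψ : 0 < Real.sin ψ) (hψ0 : 0 ≤ ψ)
    (hψπ : ψ ≤ Real.pi) (hαψ : α * ψ ≤ Real.pi / 2) {ρ : ℝ} (hρ : 0 < ρ) (hR : ρ ≤ R)
    (hr : 0 ≤ r) :
    ‖hankelKernelDeriv α θ (rayPoint ψ R r)‖ ≤ Real.exp (r * Real.cos ψ) * (Real.exp R *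
      ((1 + θ * (ρ * Real.sin ψ) ^ (α - 1)) * (ρ * Real.sin ψ) ^ (α - 1) +
        (ρ * Real.sin ψ) ^ (α - 2))) := by
  have hR0 : 0 < R := hρ.trans_le hR
  have h1 := norm_exp_rayPoint_le (R := R) (r := r) hα hθ hψ hψ0 hψπ hαψ hR0.le hr (Or.inl hR0)
  have hc : 0 ≤ Real.cos (α * ψ) :=
    Real.cos_nonneg_of_neg_pi_div_two_le_of_le (by nlinarith [Real.pi_pos]) hαψ
  have h1' : ‖Complex.exp (rayPoint ψ R r - θ * rayPoint ψ R r ^ (α : ℂ))‖ ≤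
      Real.exp (r * Real.cos ψ) * Real.exp R := by
    refine h1.trans (mul_le_mul_of_nonneg_left ?_ (by positivity))
    refine mul_le_of_le_one_right (by positivity) ?_
    rw [Real.exp_le_one_iff]
    have : 0 ≤ θ * (Real.cos (α * ψ) * (R * Real.sin ψ) ^ α) := by positivity
    linarith
  have hz : ρ * Real.sin ψ ≤ ‖rayPoint ψ R r‖ :=
    (mul_le_mul_of_nonneg_right hR hψ.le).trans vertex_le_norm_rayPoint
  have h2 : ‖rayPoint ψ R r‖ ^ (α - 1) ≤ (ρ * Real.sin ψ) ^ (α - 1) :=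
    Real.rpow_le_rpow_of_nonpos (by positivity) hz (by linarith)
  have h3 : ‖rayPoint ψ R r‖ ^ (α - 2) ≤ (ρ * Real.sin ψ) ^ (α - 2) :=
    Real.rpow_le_rpow_of_nonpos (by positivity) hz (by linarith)
  rw [hankelKernelDeriv, norm_mul, ← mul_assoc (Real.exp _)]
  refine mul_le_mul h1' ?_ (norm_nonneg _) (by positivity)
  refine (norm_add_le _ _).trans (add_le_add ?_ ?_)
  · rw [norm_mul, Complex.norm_cpow_real]
    refine mul_le_mul ?_ h2 (by positivity) (by positivity)
    refine (norm_sub_le _ _).trans (add_le_add (by simp) ?_)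
    rw [norm_mul, norm_mul, Complex.norm_cpow_real, Complex.norm_real, Complex.norm_real,
      Real.norm_of_nonneg hθ, Real.norm_of_nonneg hα.le]
    refine mul_le_mul_of_nonneg_left ?_ hθ
    exact (mul_le_of_le_one_left (by positivity) hα1).trans h2
  · rw [norm_mul, Complex.norm_cpow_real, Complex.norm_real, Real.norm_eq_abs,
      abs_of_nonpos (by linarith)]
    exact (mul_le_of_le_one_left (by positivity) (by linarith)).trans h3

theorem integrableOn_hankelKernel_rayPoint (hα : 0 < α) (hα1 : α ≤ 1) (hθ : 0 ≤ θ)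
    (hψ : 0 < Real.sin ψ) (hψ0 : 0 ≤ ψ)
    (hψπ : ψ ≤ Real.pi) (hcos : Real.cos ψ < 0) (hαψ : α * ψ ≤ Real.pi / 2) (hR : 0 ≤ R) :
    IntegrableOn (fun r => hankelKernel α θ (rayPoint ψ R r)) (Set.Ioi 0) := by
  refine Integrable.mono' ((integrableOn_rpow_mul_exp_mul (s := α - 1) (by linarith)
    hcos).mul_const (Real.sin ψ ^ (α - 1) *
        (Real.exp R * Real.exp (-(θ * (Real.cos (α * ψ) * (R * Real.sin ψ) ^ α))))))
    ((continuousOn_hankelKernel_rayPoint hψ).aestronglyMeasurable measurableSet_Ioi) ?_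
  filter_upwards [ae_restrict_mem measurableSet_Ioi] with r hr
  exact norm_hankelKernel_rayPoint_le hα hα1 hθ hψ hψ0 hψπ hαψ hR hr

/-- Moving the vertex of the ray along the positive reals changes the integral by the integral of
the kernel over a real segment. -/
theorem hasDerivAt_hankelRay (hα : 0 < α) (hα1 : α ≤ 1) (hθ : 0 ≤ θ)
    (hψ : 0 < Real.sin ψ) (hψ0 : 0 ≤ ψ)
    (hψπ : ψ ≤ Real.pi) (hcos : Real.cos ψ < 0) (hαψ : α * ψ ≤ Real.pi / 2) (hR : 0 < R) :
    HasDerivAt (hankelRay α ψ θ) (-hankelKernel α θ R) R := by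
  have hexp : IntegrableOn (fun r : ℝ => Real.exp (r * Real.cos ψ)) (Set.Ioi 0) := by
    simpa using integrableOn_rpow_mul_exp_mul (s := 0) (by norm_num) hcos
  have hcont' : ContinuousOn (fun r => hankelKernelDeriv α θ (rayPoint ψ R r)) (Set.Ioi 0) := by
    have hray : Continuous (fun r => rayPoint ψ R r) := by unfold rayPoint; fun_prop
    have hp : ∀ c : ℂ, ContinuousOn (fun r => rayPoint ψ R r ^ c) (Set.Ioi 0) := fun c =>
      hray.continuousOn.cpow_const (fun _ hr =>
        rayPoint_mem_slitPlane hψ (le_of_lt hr) (Or.inr hr))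
    unfold hankelKernelDeriv
    have := hp α
    have := hp (α - 1 : ℝ)
    have := hp (α - 2 : ℝ)
    fun_prop
  have hker : ∀ {z : ℂ}, ‖z * Complex.exp (ψ * Complex.I)‖ = ‖z‖ := by
    intro z; rw [norm_mul, Complex.norm_exp_ofReal_mul_I, mul_one]
  have key := hasDerivAt_integral_of_dominated_loc_of_deriv_le (𝕜 := ℝ)
    (μ := volume.restrict (Set.Ioi 0)) (x₀ := R) (s := Set.Ioo (R / 2) (2 * R))
    (F := fun R r => hankelKernel α θ (rayPoint ψ R r) * Complex.exp (ψ * Complex.I))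
    (F' := fun R r => hankelKernelDeriv α θ (rayPoint ψ R r) * Complex.exp (ψ * Complex.I))
    (bound := fun r => Real.exp (r * Real.cos ψ) * (Real.exp (2 * R) *
      ((1 + θ * (R / 2 * Real.sin ψ) ^ (α - 1)) * (R / 2 * Real.sin ψ) ^ (α - 1) +
        (R / 2 * Real.sin ψ) ^ (α - 2))))
    (Ioo_mem_nhds (by linarith) (by linarith)) ?_ ?_ ?_ ?_ ?_ ?_
  · refine key.2.congr_deriv ?_
    have hlim : Tendsto (fun r => hankelKernel α θ (rayPoint ψ R r)) atTop (𝓝 0) := by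
      have hb : Tendsto (fun r : ℝ => r ^ (α - 1) * Real.exp (r * Real.cos ψ) *
          (Real.sin ψ ^ (α - 1) * (Real.exp R *
            Real.exp (-(θ * (Real.cos (α * ψ) * (R * Real.sin ψ) ^ α)))))) atTop (𝓝 0) := by
        have := tendsto_rpow_mul_exp_neg_mul_atTop_nhds_zero (α - 1) (-Real.cos ψ) (by linarith)
        have := this.mul_const (Real.sin ψ ^ (α - 1) * (Real.exp R *
            Real.exp (-(θ * (Real.cos (α * ψ) * (R * Real.sin ψ) ^ α)))))
        simpa [mul_comm] using this
      refine squeeze_zero_norm' ?_ hb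
      filter_upwards [eventually_gt_atTop 0] with r hr
      exact norm_hankelKernel_rayPoint_le hα hα1 hθ hψ hψ0 hψπ hαψ hR.le hr
    have hd : ∀ r, 0 ≤ r → HasDerivAt (fun r => hankelKernel α θ (rayPoint ψ R r))
        (hankelKernelDeriv α θ (rayPoint ψ R r) * Complex.exp (ψ * Complex.I)) r := fun r hr =>
      (hasDerivAt_hankelKernel (rayPoint_mem_slitPlane hψ hr (Or.inl hR))).comp r
        hasDerivAt_rayPoint_right
    have := integral_Ioi_of_hasDerivAt_of_tendsto (hd 0 le_rfl).continuousAt.continuousWithinAt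
      (fun r hr => hd r (le_of_lt hr)) key.1 hlim
    rw [this]
    simp [rayPoint]
  · filter_upwards [lt_mem_nhds hR] with R' hR'
    exact ((continuousOn_hankelKernel_rayPoint hψ).mul
      continuousOn_const).aestronglyMeasurable measurableSet_Ioi
  · exact (integrableOn_hankelKernel_rayPoint hα hα1 hθ hψ hψ0 hψπ hcos hαψ hR.le).mul_const _
  · exact (hcont'.mul continuousOn_const).aestronglyMeasurable measurableSet_Ioi
  · filter_upwards [ae_restrict_mem measurableSet_Ioi] with r hr R' hR'
    rw [hker]
    refine (norm_hankelKernelDeriv_le hα hα1 hθ hψ hψ0 hψπ hαψ (half_pos hR) hR'.1.le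
      (le_of_lt hr)).trans ?_
    have := hR'.2.le
    gcongr
  · exact hexp.mul_const _
  · filter_upwards [ae_restrict_mem measurableSet_Ioi] with r hr R' hR'
    have hR'0 : 0 < R' := (half_pos hR).trans hR'.1
    have := (hasDerivAt_hankelKernel (α := α) (θ := θ) (rayPoint_mem_slitPlane hψ
      (le_of_lt hr) (Or.inr hr))).comp (𝕜 := ℝ) R' hasDerivAt_rayPoint_left
    simpa using this.mul_const (Complex.exp (ψ * Complex.I))

theorem norm_hankelRay_le (hα : 0 < α) (hα1 : α ≤ 1) (hθ : 0 ≤ θ)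
    (hψ : 0 < Real.sin ψ) (hψ0 : 0 ≤ ψ)
    (hψπ : ψ ≤ Real.pi) (hcos : Real.cos ψ < 0) (hαψ : α * ψ ≤ Real.pi / 2) (hR : 0 ≤ R) :
    ‖hankelRay α ψ θ R‖ ≤
      (∫ r in Set.Ioi (0 : ℝ), r ^ (α - 1) * Real.exp (r * Real.cos ψ)) * (Real.sin ψ ^ (α - 1) *
        (Real.exp R * Real.exp (-(θ * (Real.cos (α * ψ) * (R * Real.sin ψ) ^ α))))) := by
  rw [← integral_mul_const]
  refine norm_integral_le_of_norm_le
    ((integrableOn_rpow_mul_exp_mul (s := α - 1) (by linarith) hcos).mul_const _) ?_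
  filter_upwards [ae_restrict_mem measurableSet_Ioi] with r hr
  rw [norm_mul, Complex.norm_exp_ofReal_mul_I, mul_one]
  exact norm_hankelKernel_rayPoint_le hα hα1 hθ hψ hψ0 hψπ hαψ hR hr

theorem continuousWithinAt_hankelRay_zero (hα : 0 < α) (hα1 : α ≤ 1) (hθ : 0 ≤ θ)
    (hψ : 0 < Real.sin ψ) (hψ0 : 0 ≤ ψ)
    (hψπ : ψ ≤ Real.pi) (hcos : Real.cos ψ < 0) (hαψ : α * ψ ≤ Real.pi / 2) :
    ContinuousWithinAt (hankelRay α ψ θ) (Set.Ici 0) 0 := by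
  have hc : 0 ≤ Real.cos (α * ψ) :=
    Real.cos_nonneg_of_neg_pi_div_two_le_of_le (by nlinarith [Real.pi_pos]) hαψ
  have hI : Set.Icc (0 : ℝ) 1 ∈ 𝓝[Set.Ici 0] (0 : ℝ) := Icc_mem_nhdsGE one_pos
  refine continuousWithinAt_of_dominated
    (bound := fun r => r ^ (α - 1) * Real.exp (r * Real.cos ψ) * (Real.sin ψ ^ (α - 1) *
        (Real.exp 1 * 1))) ?_ ?_
    ((integrableOn_rpow_mul_exp_mul (s := α - 1) (by linarith) hcos).mul_const _) ?_
  · filter_upwards [self_mem_nhdsWithin] with R' hR'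
    exact ((continuousOn_hankelKernel_rayPoint hψ).mul
      continuousOn_const).aestronglyMeasurable measurableSet_Ioi
  · filter_upwards [hI] with R' hR'
    filter_upwards [ae_restrict_mem measurableSet_Ioi] with r hr
    rw [norm_mul, Complex.norm_exp_ofReal_mul_I, mul_one]
    refine (norm_hankelKernel_rayPoint_le hα hα1 hθ hψ hψ0 hψπ hαψ hR'.1 hr).trans ?_
    have h0 : 0 ≤ θ * (Real.cos (α * ψ) * (R' * Real.sin ψ) ^ α) := by
      have := hR'.1; positivity
    have hr' : (0 : ℝ) ≤ r := le_of_lt hr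
    have h1 : Real.exp (-(θ * (Real.cos (α * ψ) * (R' * Real.sin ψ) ^ α))) ≤ 1 := by
      rw [Real.exp_le_one_iff]; linarith
    have h2 := hR'.2
    gcongr
  · filter_upwards [ae_restrict_mem measurableSet_Ioi] with r hr
    have := (hasDerivAt_hankelKernel (α := α) (θ := θ) (rayPoint_mem_slitPlane (R := 0) hψ
      (le_of_lt hr) (Or.inr hr))).comp (𝕜 := ℝ) 0 hasDerivAt_rayPoint_left
    exact (this.continuousAt.mul continuousAt_const).continuousWithinAt

/-- On the real axis the kernel is real, so that moving the vertex does not change the imaginary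
part of the ray integral. -/
theorem im_hankelRay_eq (hα : 0 < α) (hα1 : α ≤ 1) (hθ : 0 ≤ θ)
    (hψ : 0 < Real.sin ψ) (hψ0 : 0 ≤ ψ)
    (hψπ : ψ ≤ Real.pi) (hcos : Real.cos ψ < 0) (hαψ : α * ψ ≤ Real.pi / 2) (hR : 0 ≤ R) :
    (hankelRay α ψ θ R).im = (hankelRay α ψ θ 0).im := by
  have hd : ∀ R, 0 < R → HasDerivAt (fun R => (hankelRay α ψ θ R).im) 0 R := fun R hR => by
    have h1 := Complex.imCLM.hasFDerivAt.comp_hasDerivAt R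
      (hasDerivAt_hankelRay hα hα1 hθ hψ hψ0 hψπ hcos hαψ hR)
    refine h1.congr_deriv ?_
    have : hankelKernel α θ R =
        ((Real.exp (R - θ * R ^ α) * R ^ (α - 1) : ℝ) : ℂ) := by
      rw [hankelKernel, ← Complex.ofReal_cpow hR.le, ← Complex.ofReal_cpow hR.le]
      push_cast; rfl
    rw [this, ← Complex.ofReal_neg]
    simp only [Complex.imCLM_apply, Complex.ofReal_im]
  have hcont : ContinuousOn (fun R => (hankelRay α ψ θ R).im) (Set.Ici 0) := by
    intro R hR
    rcases (Set.mem_Ici.1 hR).eq_or_lt with rfl | hR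
    · exact Complex.continuous_im.continuousAt.comp_continuousWithinAt
        (continuousWithinAt_hankelRay_zero hα hα1 hθ hψ hψ0 hψπ hcos hαψ)
    · exact (hd R hR).continuousAt.continuousWithinAt
  have hd' : DifferentiableOn ℝ (fun R => (hankelRay α ψ θ R).im) (interior (Set.Ici 0)) := by
    rw [interior_Ici]
    exact fun R hR => (hd R hR).differentiableAt.differentiableWithinAt
  refine le_antisymm ?_ ?_
  · refine antitoneOn_of_deriv_nonpos (convex_Ici 0) hcont hd' ?_ Set.self_mem_Ici hR hR
    rw [interior_Ici]
    exact fun R hR => (hd R hR).deriv.le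
  · refine monotoneOn_of_deriv_nonneg (convex_Ici 0) hcont hd' ?_ Set.self_mem_Ici hR hR
    rw [interior_Ici]
    exact fun R hR => (hd R hR).deriv.ge

end Ray

/-! ### The Wright function as a Hankel integral, and its decay -/

/-- The integral of `z ^ (s - 1) exp z` along the ray of direction `exp (i φ)`, in polar form. -/
noncomputable def gammaRay (s φ : ℝ) : ℂ :=
  ∫ r in Set.Ioi (0 : ℝ), Complex.exp (s * φ * Complex.I) * ((r ^ (s - 1) : ℝ) : ℂ) *
    Complex.exp (r * Complex.exp (φ * Complex.I))

theorem norm_exp_mul_exp_ofReal_mul_I (r φ : ℝ) :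
    ‖Complex.exp (r * Complex.exp (φ * Complex.I))‖ = Real.exp (r * Real.cos φ) := by
  rw [Complex.norm_exp, Complex.re_ofReal_mul, Complex.exp_ofReal_mul_I_re]

theorem norm_exp_ofReal_mul_ofReal_mul_I (s φ : ℝ) :
    ‖Complex.exp (s * φ * Complex.I)‖ = 1 := by
  rw [← Complex.ofReal_mul, Complex.norm_exp_ofReal_mul_I]

theorem continuousOn_gammaRay_integrand (s φ : ℝ) : ContinuousOn (fun r : ℝ =>
    Complex.exp (s * φ * Complex.I) * ((r ^ (s - 1) : ℝ) : ℂ) *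
      Complex.exp (r * Complex.exp (φ * Complex.I))) (Set.Ioi 0) := by
  have : ContinuousOn (fun r : ℝ => ((r ^ (s - 1) : ℝ) : ℂ)) (Set.Ioi 0) :=
    Complex.continuous_ofReal.comp_continuousOn
      (continuousOn_id.rpow_const fun r hr => Or.inl (ne_of_gt hr))
  fun_prop

theorem integrableOn_gammaRay_integrand {s φ : ℝ} (hs : 0 < s) (hφ : Real.cos φ < 0) :
    IntegrableOn (fun r : ℝ => Complex.exp (s * φ * Complex.I) * ((r ^ (s - 1) : ℝ) : ℂ) *
      Complex.exp (r * Complex.exp (φ * Complex.I))) (Set.Ioi 0) := by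
  refine Integrable.mono' (integrableOn_rpow_mul_exp_mul (s := s - 1) (by linarith) hφ)
    ((continuousOn_gammaRay_integrand s φ).aestronglyMeasurable measurableSet_Ioi) ?_
  filter_upwards [ae_restrict_mem measurableSet_Ioi] with r hr
  have hr' : (0 : ℝ) ≤ r := le_of_lt hr
  rw [norm_mul, norm_mul, norm_exp_mul_exp_ofReal_mul_I, norm_exp_ofReal_mul_ofReal_mul_I, one_mul,
    Complex.norm_real, Real.norm_of_nonneg (by positivity)]

/-- Rotating the ray does not change the integral, as long as `exp z` decays along it: the
derivative in the angle of the integrand is a total derivative in the radius. -/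
theorem hasDerivAt_gammaRay {s φ : ℝ} (hs : 0 < s) (hφ : Real.cos φ < 0) :
    HasDerivAt (gammaRay s) 0 φ := by
  set c := Real.cos φ / 2 with hc
  have hc0 : c < 0 := by rw [hc]; linarith
  have key := hasDerivAt_integral_of_dominated_loc_of_deriv_le (𝕜 := ℝ)
    (μ := volume.restrict (Set.Ioi 0)) (x₀ := φ) (s := {x | Real.cos x < c})
    (F := fun φ r => Complex.exp (s * φ * Complex.I) * ((r ^ (s - 1) : ℝ) : ℂ) *
      Complex.exp (r * Complex.exp (φ * Complex.I)))
    (F' := fun φ r => Complex.I * (Complex.exp (s * φ * Complex.I) * ((r ^ (s - 1) : ℝ) : ℂ) *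
      Complex.exp (r * Complex.exp (φ * Complex.I)) * (s + r * Complex.exp (φ * Complex.I))))
    (bound := fun r => s * (r ^ (s - 1) * Real.exp (r * c)) + r ^ s * Real.exp (r * c))
    ((isOpen_lt Real.continuous_cos continuous_const).mem_nhds (by
      change Real.cos φ < c
      rw [hc]; linarith)) ?_
    (integrableOn_gammaRay_integrand hs hφ) ?_ ?_
    (((integrableOn_rpow_mul_exp_mul (by linarith) hc0).const_mul s).add
      (integrableOn_rpow_mul_exp_mul (by linarith) hc0)) ?_
  · refine key.2.congr_deriv ?_
    have hd : ∀ r ∈ Set.Ioi (0 : ℝ), HasDerivAt (fun r : ℝ => Complex.I *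
        (Complex.exp (s * φ * Complex.I) * ((r ^ s : ℝ) : ℂ) *
          Complex.exp (r * Complex.exp (φ * Complex.I))))
        (Complex.I * (Complex.exp (s * φ * Complex.I) * ((r ^ (s - 1) : ℝ) : ℂ) *
          Complex.exp (r * Complex.exp (φ * Complex.I)) *
            (s + r * Complex.exp (φ * Complex.I)))) r := fun r hr => by
      have h1 := (Real.hasDerivAt_rpow_const (x := r) (p := s) (Or.inl (ne_of_gt hr))).ofReal_comp
      have h2 := ((Complex.ofRealCLM.hasDerivAt (x := r)).mul_const
        (Complex.exp (φ * Complex.I))).cexp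
      refine (((h1.const_mul (Complex.exp (s * φ * Complex.I))).mul h2).const_mul
        Complex.I).congr_deriv ?_
      have h3 : r ^ s = r ^ (s - 1) * r := by
        rw [Real.rpow_sub_one (ne_of_gt hr), div_mul_cancel₀ _ (ne_of_gt hr)]
      rw [h3]
      simp only [Complex.ofRealCLM_apply]
      push_cast
      ring
    have hcont : ContinuousWithinAt (fun r : ℝ => Complex.I *
        (Complex.exp (s * φ * Complex.I) * ((r ^ s : ℝ) : ℂ) *
          Complex.exp (r * Complex.exp (φ * Complex.I)))) (Set.Ici 0) 0 := by
      have : Continuous (fun r : ℝ => ((r ^ s : ℝ) : ℂ)) :=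
        Complex.continuous_ofReal.comp (Real.continuous_rpow_const hs.le)
      exact Continuous.continuousWithinAt (by fun_prop)
    have hlim : Tendsto (fun r : ℝ => Complex.I *
        (Complex.exp (s * φ * Complex.I) * ((r ^ s : ℝ) : ℂ) *
          Complex.exp (r * Complex.exp (φ * Complex.I)))) atTop (𝓝 0) := by
      refine squeeze_zero_norm' ?_
        (tendsto_rpow_mul_exp_neg_mul_atTop_nhds_zero s (-Real.cos φ) (by linarith))
      filter_upwards [eventually_gt_atTop 0] with r hr
      rw [norm_mul, norm_mul, norm_mul, norm_exp_mul_exp_ofReal_mul_I,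
        norm_exp_ofReal_mul_ofReal_mul_I, one_mul, Complex.norm_I, one_mul,
        Complex.norm_real, Real.norm_of_nonneg (by positivity), neg_neg, mul_comm r]
    rw [integral_Ioi_of_hasDerivAt_of_tendsto hcont hd key.1 hlim]
    simp [Real.zero_rpow hs.ne']
  · exact Eventually.of_forall fun x =>
      (continuousOn_gammaRay_integrand s x).aestronglyMeasurable measurableSet_Ioi
  · have := continuousOn_gammaRay_integrand s φ
    refine ContinuousOn.aestronglyMeasurable ?_ measurableSet_Ioi
    refine continuousOn_const.mul (this.mul ?_)
    fun_prop
  · filter_upwards [ae_restrict_mem measurableSet_Ioi] with r hr x hx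
    have hr' : (0 : ℝ) < r := hr
    rw [norm_mul, norm_mul, norm_mul, norm_mul, norm_exp_mul_exp_ofReal_mul_I,
      norm_exp_ofReal_mul_ofReal_mul_I, one_mul, Complex.norm_I, one_mul,
      Complex.norm_real, Real.norm_of_nonneg (by positivity)]
    have h1 : ‖(s : ℂ) + r * Complex.exp (x * Complex.I)‖ ≤ s + r := by
      refine (norm_add_le _ _).trans (le_of_eq ?_)
      rw [norm_mul, Complex.norm_exp_ofReal_mul_I, Complex.norm_real, Complex.norm_real,
        Real.norm_of_nonneg hs.le, Real.norm_of_nonneg hr'.le, mul_one]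
    have h2 : Real.exp (r * Real.cos x) ≤ Real.exp (r * c) :=
      Real.exp_le_exp.2 (mul_le_mul_of_nonneg_left (le_of_lt hx) hr'.le)
    have h3 : r ^ s = r ^ (s - 1) * r := by
      rw [Real.rpow_sub_one (ne_of_gt hr), div_mul_cancel₀ _ (ne_of_gt hr)]
    calc _ ≤ r ^ (s - 1) * Real.exp (r * c) * (s + r) := by gcongr
      _ = _ := by rw [h3]; ring
  · filter_upwards [ae_restrict_mem measurableSet_Ioi] with r hr x hx
    have h1 := (((Complex.ofRealCLM.hasDerivAt (x := x)).const_mul (s : ℂ)).mul_const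
      Complex.I).cexp
    have h2 := (((((Complex.ofRealCLM.hasDerivAt (x := x)).mul_const
      Complex.I).cexp).const_mul (r : ℂ))).cexp
    refine ((h1.mul_const ((r ^ (s - 1) : ℝ) : ℂ)).mul h2).congr_deriv ?_
    simp only [Complex.ofRealCLM_apply]
    push_cast
    ring

theorem gammaRay_eq {s φ : ℝ} (hs : 0 < s) (hφ : Real.pi / 2 < φ) (hφ' : φ ≤ Real.pi) :
    gammaRay s φ = Complex.exp (s * Real.pi * Complex.I) * Real.Gamma s := by
  have hcos : ∀ x ∈ Set.Ioo (Real.pi / 2) (Real.pi + Real.pi / 2), Real.cos x < 0 :=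
    fun x hx => Real.cos_neg_of_pi_div_two_lt_of_lt hx.1 hx.2
  have h1 : gammaRay s φ = gammaRay s Real.pi := by
    refine isOpen_Ioo.is_const_of_deriv_eq_zero (s := Set.Ioo (Real.pi / 2)
      (Real.pi + Real.pi / 2)) isPreconnected_Ioo
      (fun x hx => (hasDerivAt_gammaRay hs (hcos x hx)).differentiableAt.differentiableWithinAt)
      (fun x hx => (hasDerivAt_gammaRay hs (hcos x hx)).deriv) ?_ ?_
    · exact ⟨hφ, by linarith [Real.pi_pos]⟩
    · exact ⟨by linarith [Real.pi_pos], by linarith [Real.pi_pos]⟩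
  rw [h1, gammaRay, Real.Gamma_eq_integral hs, ← integral_complex_ofReal, ← integral_const_mul]
  refine setIntegral_congr_fun measurableSet_Ioi fun r _ => ?_
  simp only [Complex.exp_pi_mul_I]
  push_cast
  rw [mul_neg, mul_one]
  ring

/-- Sublinear powers are dominated by arbitrarily flat affine functions. -/
theorem exists_rpow_le_add_mul {α ε : ℝ} (hα : 0 ≤ α) (hα1 : α < 1) (hε : 0 < ε) :
    ∃ C : ℝ, ∀ r : ℝ, 0 < r → r ^ α ≤ C + ε * r := by
  have h : Tendsto (fun r : ℝ => r ^ (-(1 - α))) atTop (𝓝 0) :=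
    tendsto_rpow_neg_atTop (by linarith)
  obtain ⟨r₀, hr₀⟩ := eventually_atTop.1 ((h.eventually (gt_mem_nhds hε)).and
    (eventually_gt_atTop 0))
  refine ⟨r₀ ^ α, fun r hr => ?_⟩
  have h0 : 0 < r₀ := (hr₀ r₀ le_rfl).2
  rcases le_total r r₀ with hle | hle
  · have := Real.rpow_le_rpow hr.le hle hα
    nlinarith
  · have h1 : r ^ α = r ^ (-(1 - α)) * r := by
      rw [← Real.rpow_add_one hr.ne']; congr 1; ring
    have h2 : r ^ (-(1 - α)) * r ≤ ε * r :=
      mul_le_mul_of_nonneg_right (hr₀ r hle).1.le hr.le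
    have h3 : 0 ≤ r₀ ^ α := by positivity
    rw [h1]; linarith

/-- Expanding the exponential in the Hankel kernel on the ray issuing from the origin. -/
theorem hasSum_hankelRay_zero {α ψ θ : ℝ} (hα : 0 < α) (hα1 : α < 1)
    (hψ : Real.pi / 2 < ψ) (hψ' : ψ ≤ Real.pi) :
    HasSum (fun m : ℕ => ((-θ) ^ m / m.factorial : ℝ) * gammaRay (α * (m + 1)) ψ)
      (hankelRay α ψ θ 0) := by
  have hcos : Real.cos ψ < 0 :=
    Real.cos_neg_of_pi_div_two_lt_of_lt hψ (by linarith [Real.pi_pos])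
  have hlog : ∀ r : ℝ, 0 < r → ∀ c : ℝ, (rayPoint ψ 0 r) ^ (c : ℂ) =
      ((r ^ c : ℝ) : ℂ) * Complex.exp (c * ψ * Complex.I) := fun r hr c => by
    have hz : rayPoint ψ 0 r = r * Complex.exp (ψ * Complex.I) := by simp [rayPoint]
    have hr' : (r : ℂ) ≠ 0 := Complex.ofReal_ne_zero.2 hr.ne'
    rw [hz, Complex.cpow_def_of_ne_zero (mul_ne_zero hr' (Complex.exp_ne_zero _)),
      Complex.log_ofReal_mul hr (Complex.exp_ne_zero _), Complex.log_exp (by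
        simp; linarith [Real.pi_pos]) (by simpa using hψ'), Real.rpow_def_of_pos hr, add_mul,
      Complex.exp_add]
    push_cast
    ring_nf
  have hpt : ∀ r ∈ Set.Ioi (0 : ℝ),
      HasSum (fun m : ℕ => ((-θ) ^ m / m.factorial : ℝ) *
        (Complex.exp ((α * (m + 1) : ℝ) * ψ * Complex.I) *
          ((r ^ (α * (m + 1) - 1) : ℝ) : ℂ) * Complex.exp (r * Complex.exp (ψ * Complex.I))))
        (hankelKernel α θ (rayPoint ψ 0 r) * Complex.exp (ψ * Complex.I)) := fun r hr => by
    have hr0 : (0 : ℝ) < r := hr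
    have h1 := NormedSpace.expSeries_div_hasSum_exp
      (-(θ * (((r ^ α : ℝ) : ℂ) * Complex.exp (α * ψ * Complex.I))))
    rw [← Complex.exp_eq_exp_ℂ] at h1
    have h2 := h1.mul_right (Complex.exp (r * Complex.exp (ψ * Complex.I)) *
      ((r ^ (α - 1) : ℝ) : ℂ) * Complex.exp (α * ψ * Complex.I))
    have hval : hankelKernel α θ (rayPoint ψ 0 r) * Complex.exp (ψ * Complex.I) =
        Complex.exp (-(θ * (((r ^ α : ℝ) : ℂ) * Complex.exp (α * ψ * Complex.I)))) *
          (Complex.exp (r * Complex.exp (ψ * Complex.I)) *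
            ((r ^ (α - 1) : ℝ) : ℂ) * Complex.exp (α * ψ * Complex.I)) := by
      have e3 : Complex.exp (((α - 1 : ℝ) : ℂ) * ψ * Complex.I) * Complex.exp (ψ * Complex.I) =
          Complex.exp (α * ψ * Complex.I) := by
        rw [← Complex.exp_add]; congr 1; push_cast; ring
      have hz : rayPoint ψ 0 r = r * Complex.exp (ψ * Complex.I) := by simp [rayPoint]
      rw [hankelKernel, hlog r hr0, hlog r hr0, Complex.exp_sub, Complex.exp_neg, ← e3, hz]
      field_simp
    rw [hval]
    refine (congrArg (HasSum · _) (funext fun m => ?_)).mp h2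
    · have e1 : r ^ (α * (m + 1) - 1) = (r ^ α) ^ m * r ^ (α - 1) := by
        rw [← Real.rpow_natCast, ← Real.rpow_mul hr0.le, ← Real.rpow_add hr0]
        congr 1; ring
      have e2 : Complex.exp ((α * (m + 1) : ℝ) * ψ * Complex.I) =
          Complex.exp (α * ψ * Complex.I) ^ m * Complex.exp (α * ψ * Complex.I) := by
        rw [← Complex.exp_nat_mul, ← Complex.exp_add]
        congr 1; push_cast; ring
      rw [e1, e2]
      push_cast
      rw [neg_pow (θ : ℂ), neg_pow ((θ : ℂ) * _), mul_pow, mul_pow]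
      ring
  have hnorm : ∀ r ∈ Set.Ioi (0 : ℝ), ∀ m : ℕ, ‖(((-θ) ^ m / m.factorial : ℝ) : ℂ) *
        (Complex.exp ((α * (m + 1) : ℝ) * ψ * Complex.I) *
          ((r ^ (α * (m + 1) - 1) : ℝ) : ℂ) * Complex.exp (r * Complex.exp (ψ * Complex.I)))‖ =
      (|θ| * r ^ α) ^ m / m.factorial * (r ^ (α - 1) * Real.exp (r * Real.cos ψ)) :=
    fun r hr m => by
      have hr0 : (0 : ℝ) < r := hr
      have e1 : r ^ (α * (m + 1) - 1) = (r ^ α) ^ m * r ^ (α - 1) := by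
        rw [← Real.rpow_natCast, ← Real.rpow_mul hr0.le, ← Real.rpow_add hr0]
        congr 1; ring
      rw [norm_mul, norm_mul, norm_mul, norm_exp_mul_exp_ofReal_mul_I,
        norm_exp_ofReal_mul_ofReal_mul_I, Complex.norm_real, Complex.norm_real,
        norm_div, norm_pow, norm_neg, Real.norm_eq_abs θ, Real.norm_of_nonneg (by positivity),
        Real.norm_of_nonneg (by positivity), e1, mul_pow]
      ring
  have hsum : ∀ r : ℝ, HasSum (fun m : ℕ => (|θ| * r ^ α) ^ m / m.factorial *
      (r ^ (α - 1) * Real.exp (r * Real.cos ψ)))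
      (Real.exp (|θ| * r ^ α) * (r ^ (α - 1) * Real.exp (r * Real.cos ψ))) := fun r => by
    have := NormedSpace.expSeries_div_hasSum_exp (|θ| * r ^ α)
    rw [← Real.exp_eq_exp_ℝ] at this
    exact this.mul_right _
  have key := hasSum_integral_of_dominated_convergence (μ := volume.restrict (Set.Ioi 0))
    (F := fun (m : ℕ) (r : ℝ) => (((-θ) ^ m / m.factorial : ℝ) : ℂ) *
        (Complex.exp ((α * (m + 1) : ℝ) * ψ * Complex.I) *
          ((r ^ (α * (m + 1) - 1) : ℝ) : ℂ) * Complex.exp (r * Complex.exp (ψ * Complex.I))))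
    (f := fun r => hankelKernel α θ (rayPoint ψ 0 r) * Complex.exp (ψ * Complex.I))
    (fun (m : ℕ) (r : ℝ) => (|θ| * r ^ α) ^ m / m.factorial *
      (r ^ (α - 1) * Real.exp (r * Real.cos ψ))) ?_ ?_ ?_ ?_ ?_
  · simp only [integral_const_mul] at key
    exact key
  · intro m
    exact (continuousOn_const.mul (continuousOn_gammaRay_integrand _ ψ)).aestronglyMeasurable
      measurableSet_Ioi
  · intro m
    filter_upwards [ae_restrict_mem measurableSet_Ioi] with r hr
    exact (hnorm r hr m).le
  · exact Eventually.of_forall fun r => (hsum r).summable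
  · simp only [fun r => (hsum r).tsum_eq]
    -- `|θ| r ^ α` is absorbed by half of the exponential decay
    obtain ⟨C, hC⟩ := exists_rpow_le_add_mul (ε := -Real.cos ψ / 2 / (|θ| + 1)) hα.le hα1
      (by have := abs_nonneg θ; apply div_pos <;> linarith)
    refine Integrable.mono' ((integrableOn_rpow_mul_exp_mul (s := α - 1) (c := Real.cos ψ / 2)
      (by linarith) (by linarith)).const_mul (Real.exp (|θ| * C))) ?_ ?_
    · refine ContinuousOn.aestronglyMeasurable ?_ measurableSet_Ioi
      have h1 : ∀ c : ℝ, ContinuousOn (fun r : ℝ => r ^ c) (Set.Ioi 0) := fun c =>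
        continuousOn_id.rpow_const fun r hr => Or.inl (ne_of_gt hr)
      have := h1 α
      have := h1 (α - 1)
      fun_prop
    · filter_upwards [ae_restrict_mem measurableSet_Ioi] with r hr
      have hr0 : (0 : ℝ) < r := hr
      rw [Real.norm_of_nonneg (by positivity)]
      have e : Real.exp (|θ| * r ^ α) * Real.exp (r * Real.cos ψ) ≤
          Real.exp (|θ| * C) * Real.exp (r * (Real.cos ψ / 2)) := by
        rw [← Real.exp_add, ← Real.exp_add, Real.exp_le_exp]
        have h1 := mul_le_mul_of_nonneg_left (hC r hr0) (abs_nonneg θ)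
        have h2 : |θ| * (-Real.cos ψ / 2 / (|θ| + 1)) ≤ -Real.cos ψ / 2 := by
          have := abs_nonneg θ
          rw [mul_div_assoc', div_le_iff₀ (by linarith)]
          nlinarith
        have h3 := mul_le_mul_of_nonneg_right h2 hr0.le
        linarith
      have := mul_le_mul_of_nonneg_left e (by positivity : (0 : ℝ) ≤ r ^ (α - 1))
      linarith
  · filter_upwards [ae_restrict_mem measurableSet_Ioi] with r hr
    exact hpt r hr

theorem sin_mul_Gamma_eq {s : ℝ} (hs : 0 < s) :
    Real.sin (s * Real.pi) * Real.Gamma s = Real.pi / Real.Gamma (1 - s) := by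
  have h := Real.Gamma_mul_Gamma_one_sub s
  rw [mul_comm Real.pi s] at h
  have hg := (Real.Gamma_pos_of_pos hs).ne'
  have hpi := Real.pi_pos.ne'
  by_cases h1 : Real.Gamma (1 - s) = 0
  · rw [h1, mul_zero, eq_comm, div_eq_zero_iff] at h
    rw [h1, h.resolve_left hpi]
    simp
  · have hsin : Real.sin (s * Real.pi) ≠ 0 := fun h0 => by
      rw [h0, div_zero] at h
      exact mul_ne_zero hg h1 h
    rw [eq_div_iff hsin] at h
    rw [eq_div_iff h1]
    linarith

/-- The defining series of the Wright function converges, and its sum is a Hankel integral. -/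
theorem hasSum_wright {α ψ θ : ℝ} (hα : 0 < α) (hα1 : α < 1)
    (hψ : Real.pi / 2 < ψ) (hψ' : ψ ≤ Real.pi) :
    HasSum (fun m : ℕ => (-θ) ^ m / ((m.factorial : ℝ) * Real.Gamma (-α * m + 1 - α)))
      ((hankelRay α ψ θ 0).im / Real.pi) := by
  have h := (Complex.hasSum_im (hasSum_hankelRay_zero (θ := θ) hα hα1 hψ hψ')).div_const Real.pi
  refine (congrArg (HasSum · _) (funext fun m => ?_)).mp h
  have hs : 0 < α * (m + 1) := by positivity
  have e := sin_mul_Gamma_eq hs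
  rw [gammaRay_eq hs hψ hψ', Complex.im_ofReal_mul, Complex.im_mul_ofReal,
    ← Complex.ofReal_mul, Complex.exp_ofReal_mul_I_im, e]
  have : -α * m + 1 - α = 1 - α * (m + 1) := by ring
  rw [this]
  have hpi := Real.pi_pos.ne'
  field_simp

theorem summable_wright {α : ℝ} (hα : 0 < α) (hα1 : α < 1) (θ : ℝ) :
    Summable (fun m : ℕ => (-θ) ^ m / ((m.factorial : ℝ) * Real.Gamma (-α * m + 1 - α))) :=
  (hasSum_wright hα hα1 (by linarith [Real.pi_pos]) le_rfl).summable

theorem measurable_wright {α : ℝ} (hα : 0 < α) (hα1 : α < 1) : Measurable (wright α) := by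
  refine measurable_of_tendsto_metrizable (f := fun (n : ℕ) (θ : ℝ) =>
    ∑ m ∈ Finset.range n, (-θ) ^ m / ((m.factorial : ℝ) * Real.Gamma (-α * m + 1 - α)))
    (fun n => by fun_prop) ?_
  rw [tendsto_pi_nhds]
  exact fun θ => (summable_wright hα hα1 θ).hasSum.tendsto_sum_nat

/-- The Wright function decays faster than every exponential. -/
theorem exists_abs_wright_le {α : ℝ} (hα : 0 < α) (hα1 : α < 1) {C : ℝ} (hC : 0 < C) :
    ∃ K : ℝ, ∀ θ : ℝ, 0 ≤ θ → |wright α θ| ≤ K * Real.exp (-(C * θ)) := by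
  -- this direction lies in the left half plane, and its `α`-th power in the right half plane
  set ψ := Real.pi / (1 + α) with hψd
  have hπ := Real.pi_pos
  have hψ : Real.pi / 2 < ψ := div_lt_div_of_pos_left hπ (by linarith) (by linarith)
  have hψ' : ψ < Real.pi := div_lt_self hπ (by linarith)
  have hαψ : α * ψ < Real.pi / 2 := by
    have : ψ * (1 + α) = Real.pi := div_mul_cancel₀ _ (by linarith)
    linarith
  have hψ0 : 0 < ψ := by linarith
  have hsin : 0 < Real.sin ψ := Real.sin_pos_of_pos_of_lt_pi hψ0 hψ'
  have hcos : Real.cos ψ < 0 := Real.cos_neg_of_pi_div_two_lt_of_lt hψ (by linarith)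
  have hcosα : 0 < Real.cos (α * ψ) :=
    Real.cos_pos_of_mem_Ioo ⟨by nlinarith, hαψ⟩
  -- the vertex for which the kernel is bounded by `exp (- C θ)`
  set R := (C / Real.cos (α * ψ)) ^ (α⁻¹) / Real.sin ψ with hRd
  have hR : 0 < R := by positivity
  have hRC : Real.cos (α * ψ) * (R * Real.sin ψ) ^ α = C := by
    rw [hRd, div_mul_cancel₀ _ hsin.ne', ← Real.rpow_mul (by positivity), inv_mul_cancel₀ hα.ne',
      Real.rpow_one, mul_div_cancel₀ _ hcosα.ne']
  refine ⟨(∫ r in Set.Ioi (0 : ℝ), r ^ (α - 1) * Real.exp (r * Real.cos ψ)) *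
    (Real.sin ψ ^ (α - 1) * Real.exp R) / Real.pi, fun θ hθ => ?_⟩
  rw [wright, (hasSum_wright hα hα1 hψ hψ'.le).tsum_eq,
    ← im_hankelRay_eq hα hα1.le hθ hsin hψ0.le hψ'.le hcos hαψ.le hR.le, abs_div, abs_of_pos hπ,
    div_mul_eq_mul_div]
  refine div_le_div_of_nonneg_right ((Complex.abs_im_le_norm _).trans ?_) hπ.le
  have := norm_hankelRay_le hα hα1.le hθ hsin hψ0.le hψ'.le hcos hαψ.le hR.le
  rw [hRC, mul_comm θ C] at this
  linarith

/-! ### Growth and continuity of the solution operators -/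

section Semigroup

variable {H : Type*} [NormedAddCommGroup H] [NormedSpace ℝ H]

theorem C0Semigroup.tendsto_apply_zero (S : C0Semigroup H) (x : H) :
    Tendsto (fun t => S.toFun t x) (𝓝[≥] 0) (𝓝 x) := by
  rw [← Set.Ioi_insert, nhdsWithin_insert, tendsto_sup]
  refine ⟨?_, S.tendsto_zero x⟩
  have : S.toFun 0 x = x := by rw [S.map_zero]; rfl
  exact tendsto_pure_left.2 fun s hs => by
    rw [this]
    exact mem_of_mem_nhds hs

theorem C0Semigroup.apply_add (S : C0Semigroup H) {s t : ℝ} (hs : 0 ≤ s) (ht : 0 ≤ t) (x : H) :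
    S.toFun (s + t) x = S.toFun s (S.toFun t x) := by
  rw [S.map_add s t hs ht]; rfl

variable [CompleteSpace H]

theorem C0Semigroup.exists_norm_le_near_zero (S : C0Semigroup H) :
    ∃ δ > 0, ∃ M : ℝ, ∀ t, 0 ≤ t → t ≤ δ → ‖S.toFun t‖ ≤ M := by
  by_contra! hcon
  have h1 : ∀ n : ℕ, ∃ t, 0 ≤ t ∧ t ≤ 1 / ((n : ℝ) + 1) ∧ (n : ℝ) < ‖S.toFun t‖ := fun n =>
    hcon _ Nat.one_div_pos_of_nat n
  choose t ht0 ht1 ht2 using h1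
  have htend : Tendsto t atTop (𝓝[≥] 0) :=
    tendsto_nhdsWithin_iff.2 ⟨squeeze_zero ht0 ht1 tendsto_one_div_add_atTop_nhds_zero_nat,
      Eventually.of_forall ht0⟩
  obtain ⟨C, hC⟩ := banach_steinhaus (g := fun n => S.toFun (t n)) fun x => by
    obtain ⟨C, hC⟩ := ((S.tendsto_apply_zero x).comp htend).norm.bddAbove_range
    exact ⟨C, fun n => hC ⟨n, rfl⟩⟩
  obtain ⟨n, hn⟩ := exists_nat_gt C
  linarith [hC n, ht2 n]

theorem C0Semigroup.exists_norm_le_exp (S : C0Semigroup H) :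
    ∃ M > 0, ∃ ω > 0, ∀ t : ℝ, 0 ≤ t → ‖S.toFun t‖ ≤ M * Real.exp (ω * t) := by
  obtain ⟨δ, hδ, M₀, hM₀⟩ := S.exists_norm_le_near_zero
  set M := max M₀ 1 with hM
  have hM1 : 1 ≤ M := le_max_right _ _
  have hMpos : 0 < M := by linarith
  have hpow : ∀ n : ℕ, ∀ t, 0 ≤ t → t ≤ (n + 1) * δ → ‖S.toFun t‖ ≤ M ^ (n + 1) := by
    intro n
    induction n with
    | zero =>
      intro t ht ht'
      rw [zero_add, pow_one]
      exact (hM₀ t ht (by simpa using ht')).trans (le_max_left _ _)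
    | succ n ih =>
      intro t ht ht'
      rcases le_total t ((n + 1) * δ) with h | h
      · exact (ih t ht h).trans (pow_le_pow_right₀ hM1 (by omega))
      · have hn : 0 ≤ ((n : ℝ) + 1) * δ := by positivity
        have e : t = (t - (n + 1) * δ) + (n + 1) * δ := by ring
        rw [e, S.map_add _ _ (by linarith) hn, pow_succ']
        refine (norm_mul_le _ _).trans (mul_le_mul ?_ (ih _ hn le_rfl) (norm_nonneg _) hMpos.le)
        refine (hM₀ _ (by linarith) ?_).trans (le_max_left _ _)
        push_cast at ht'
        linarith
  refine ⟨M, hMpos, Real.log M / δ + 1, ?_, fun t ht => ?_⟩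
  · have := Real.log_nonneg hM1
    positivity
  · refine (hpow ⌊t / δ⌋₊ t ht ?_).trans ?_
    · rw [← div_le_iff₀ hδ]
      exact (Nat.lt_floor_add_one _).le
    · rw [pow_succ']
      refine mul_le_mul_of_nonneg_left ?_ hMpos.le
      rw [← Real.rpow_natCast, Real.rpow_def_of_pos hMpos, Real.exp_le_exp]
      have h1 := Nat.floor_le (div_nonneg ht hδ.le)
      have h2 := mul_le_mul_of_nonneg_left h1 (Real.log_nonneg hM1)
      calc _ ≤ Real.log M * (t / δ) := h2
        _ ≤ (Real.log M / δ + 1) * t := by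
          rw [add_mul, one_mul, mul_div_assoc', div_mul_eq_mul_div]; linarith

theorem C0Semigroup.continuousOn_apply (S : C0Semigroup H) (x : H) :
    ContinuousOn (fun t => S.toFun t x) (Set.Ici 0) := by
  obtain ⟨M, hM, ω, hω, hS⟩ := S.exists_norm_le_exp
  intro t₀ ht₀
  have ht₀' : 0 ≤ t₀ := ht₀
  -- both one-sided increments are controlled by `S |t - t₀| x - x`
  have hb : ∀ t ∈ Set.Icc 0 (t₀ + 1), ‖S.toFun t x - S.toFun t₀ x‖ ≤
      M * Real.exp (ω * (t₀ + 1)) * ‖S.toFun |t - t₀| x - x‖ := by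
    have hle : ∀ s, 0 ≤ s → s ≤ t₀ + 1 → ∀ y, ‖S.toFun s y‖ ≤
        M * Real.exp (ω * (t₀ + 1)) * ‖y‖ := fun s hs hs' y =>
      ((S.toFun s).le_opNorm y).trans (mul_le_mul_of_nonneg_right ((hS s hs).trans (by gcongr))
        (norm_nonneg _))
    intro t ht
    rcases le_total t₀ t with h | h
    · have e : S.toFun t x - S.toFun t₀ x = S.toFun t₀ (S.toFun |t - t₀| x - x) := by
        rw [map_sub, ← S.apply_add ht₀' (abs_nonneg _), abs_of_nonneg (by linarith)]
        congr 3; ring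
      rw [e]
      exact hle t₀ ht₀' (by linarith) _
    · have e : S.toFun t x - S.toFun t₀ x = -S.toFun t (S.toFun |t - t₀| x - x) := by
        rw [map_sub, ← S.apply_add ht.1 (abs_nonneg _), abs_of_nonpos (by linarith), neg_sub]
        congr 3; ring
      rw [e, norm_neg]
      exact hle t ht.1 ht.2 _
  rw [ContinuousWithinAt, tendsto_iff_norm_sub_tendsto_zero]
  have habs : Tendsto (fun t => |t - t₀|) (𝓝[Set.Ici 0] t₀) (𝓝[≥] 0) := by
    refine tendsto_nhdsWithin_iff.2 ⟨?_, Eventually.of_forall fun t => Set.mem_Ici.2 (abs_nonneg _)⟩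
    have : Continuous (fun t => |t - t₀|) := by fun_prop
    simpa using (this.tendsto t₀).mono_left nhdsWithin_le_nhds
  have hlim := ((tendsto_iff_norm_sub_tendsto_zero.1
    (S.tendsto_apply_zero x)).comp habs).const_mul (M * Real.exp (ω * (t₀ + 1)))
  rw [mul_zero] at hlim
  refine squeeze_zero' (Eventually.of_forall fun t => norm_nonneg _) ?_ hlim
  filter_upwards [self_mem_nhdsWithin, mem_nhdsWithin_of_mem_nhds (Iio_mem_nhds (lt_add_one t₀))]
    with t ht ht'
  exact hb t ⟨ht, le_of_lt ht'⟩

/-- On bounded time intervals, the integrands of `fracP` have a common integrable bound, because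
the Wright function decays faster than the semigroup grows. -/
theorem exists_integrable_bound_fracP (S : C0Semigroup H) {α : ℝ} (hα : 0 < α) (hα1 : α < 1)
    (T : ℝ) : ∃ g : ℝ → ℝ, IntegrableOn g (Set.Ioi 0) ∧ ∀ τ, 0 ≤ τ → τ ≤ T → ∀ θ, 0 < θ → ∀ x : H,
      ‖((α * θ * wright α θ) • S.toFun (τ ^ α * θ)) x‖ ≤ g θ * ‖x‖ := by
  obtain ⟨M, hM, ω, hω, hS⟩ := S.exists_norm_le_exp
  set C := ω * |T| ^ α + 1 with hC
  have hCpos : 0 < C := by positivity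
  obtain ⟨K, hK⟩ := exists_abs_wright_le hα hα1 hCpos
  have hK0 : 0 ≤ K := by
    have := (abs_nonneg _).trans (hK 0 le_rfl)
    simpa using this
  refine ⟨fun θ => α * K * M * (θ ^ (1 : ℝ) * Real.exp (θ * -1)),
    (integrableOn_rpow_mul_exp_mul (by norm_num) (by norm_num)).const_mul _,
    fun τ hτ hτT θ hθ x => ?_⟩
  have hτα : τ ^ α ≤ |T| ^ α := Real.rpow_le_rpow hτ (hτT.trans (le_abs_self T)) hα.le
  have h1 : ‖S.toFun (τ ^ α * θ) x‖ ≤ M * Real.exp (ω * (|T| ^ α * θ)) * ‖x‖ := by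
    refine ((S.toFun _).le_opNorm x).trans (mul_le_mul_of_nonneg_right ?_ (norm_nonneg _))
    refine (hS _ (by positivity)).trans ?_
    gcongr
  have h2 : ‖α * θ * wright α θ‖ ≤ α * θ * (K * Real.exp (-(C * θ))) := by
    rw [norm_mul, Real.norm_of_nonneg (by positivity), Real.norm_eq_abs]
    exact mul_le_mul_of_nonneg_left (hK θ hθ.le) (by positivity)
  have h3 : Real.exp (-(C * θ)) * Real.exp (ω * (|T| ^ α * θ)) = Real.exp (θ * -1) := by
    rw [← Real.exp_add, hC]; congr 1; ring
  rw [smul_apply, norm_smul]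
  beta_reduce
  rw [← h3, Real.rpow_one]
  calc _ ≤ α * θ * (K * Real.exp (-(C * θ))) * (M * Real.exp (ω * (|T| ^ α * θ)) * ‖x‖) := by
        gcongr
    _ = _ := by ring

theorem aestronglyMeasurable_fracP_integrand (S : C0Semigroup H) {α : ℝ} (hα : 0 < α)
    (hα1 : α < 1) {τ : ℝ} (hτ : 0 ≤ τ) (x : H) :
    AEStronglyMeasurable (fun θ => ((α * θ * wright α θ) • S.toFun (τ ^ α * θ)) x)
      (volume.restrict (Set.Ioi 0)) := by
  simp only [smul_apply]
  refine AEStronglyMeasurable.smul ?_ ?_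
  · have := measurable_wright hα hα1
    exact Measurable.aestronglyMeasurable (by fun_prop)
  · refine ContinuousOn.aestronglyMeasurable ?_ measurableSet_Ioi
    refine (S.continuousOn_apply x).comp (by fun_prop) fun θ hθ => ?_
    have : (0 : ℝ) ≤ θ := le_of_lt hθ
    exact Set.mem_Ici.2 (by positivity)

theorem integrableOn_fracP_integrand (S : C0Semigroup H) {α : ℝ} (hα : 0 < α)
    (hα1 : α < 1) {τ : ℝ} (hτ : 0 ≤ τ) (x : H) :
    IntegrableOn (fun θ => ((α * θ * wright α θ) • S.toFun (τ ^ α * θ)) x) (Set.Ioi 0) := by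
  obtain ⟨g, hg, hle⟩ := exists_integrable_bound_fracP S hα hα1 τ
  refine Integrable.mono' (hg.mul_const ‖x‖)
    (aestronglyMeasurable_fracP_integrand S hα hα1 hτ x) ?_
  filter_upwards [ae_restrict_mem measurableSet_Ioi] with θ hθ
  exact hle τ hτ le_rfl θ hθ x

theorem continuousOn_fracP_apply (S : C0Semigroup H) {α : ℝ} (hα : 0 < α) (hα1 : α ≤ 1) (x : H) :
    ContinuousOn (fun τ => fracP S α τ x) (Set.Ici 0) := by
  rcases hα1.eq_or_lt with rfl | hα1
  · simpa [fracP] using S.continuousOn_apply x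
  have heq : Set.EqOn (fun τ => fracP S α τ x)
      (fun τ => ∫ θ in Set.Ioi 0, ((α * θ * wright α θ) • S.toFun (τ ^ α * θ)) x)
      (Set.Ici 0) := fun τ hτ => by
    simp only [fracP, if_neg hα1.ne]
    exact strongIntegral_apply _ _ (integrableOn_fracP_integrand S hα hα1 hτ) x
  refine ContinuousOn.congr ?_ heq
  intro τ₀ hτ₀
  obtain ⟨g, hg, hle⟩ := exists_integrable_bound_fracP S hα hα1 (τ₀ + 1)
  refine continuousWithinAt_of_dominated (bound := fun θ => g θ * ‖x‖) ?_ ?_ (hg.mul_const _) ?_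
  · filter_upwards [self_mem_nhdsWithin] with τ hτ
    exact aestronglyMeasurable_fracP_integrand S hα hα1 hτ x
  · filter_upwards [self_mem_nhdsWithin,
      mem_nhdsWithin_of_mem_nhds (Iio_mem_nhds (lt_add_one τ₀))] with τ hτ hτ'
    filter_upwards [ae_restrict_mem measurableSet_Ioi] with θ hθ
    exact hle τ hτ (le_of_lt hτ') θ hθ x
  · filter_upwards [ae_restrict_mem measurableSet_Ioi] with θ hθ
    simp only [smul_apply]
    refine ContinuousWithinAt.const_smul ?_ _
    have hθ' : (0 : ℝ) ≤ θ := le_of_lt hθ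
    have hc : ContinuousOn (fun τ : ℝ => τ ^ α * θ) (Set.Ici 0) :=
      ((Real.continuous_rpow_const hα.le).mul continuous_const).continuousOn
    exact ((S.continuousOn_apply x).comp hc fun τ hτ => by
      have : (0 : ℝ) ≤ τ := hτ
      exact Set.mem_Ici.2 (by positivity)) τ₀ hτ₀

end Semigroup

/-! ### Subintervals, costates and adjoints -/

namespace System

open ContinuousLinearMap (adjoint)

set_option linter.unusedSectionVars false

variable {H U : Type*} [NormedAddCommGroup H] [InnerProductSpace ℝ H] [CompleteSpace H]
  [NormedAddCommGroup U] [InnerProductSpace ℝ U] [CompleteSpace U] (Q : System H U)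

theorem adjoint_one_add (D : H →L[ℝ] H) : adjoint (1 + D) = 1 + adjoint D := by
  rw [map_add, ← ContinuousLinearMap.star_eq_adjoint, star_one]

theorem adjoint_descProd_step (k i : ℕ) :
    adjoint (descProd Q.step k i) = ascProd Q.stepAdj i k := by
  have hstep : ∀ j, star (Q.step j) = Q.stepAdj j := fun j => by
    rw [step, star_mul, ContinuousLinearMap.star_eq_adjoint, ContinuousLinearMap.star_eq_adjoint,
      adjoint_one_add, stepAdj]
  rw [descProd, ascProd, ← ContinuousLinearMap.star_eq_adjoint]
  induction List.range' i (k + 1 - i) with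
  | nil => simp
  | cons a l ih =>
    simp only [List.reverse_cons, List.map_append, List.map_cons, List.map_nil, List.prod_append,
      List.prod_cons, List.prod_nil, mul_one, star_mul, ih, hstep]

/-- The terminal covector `y` transported backwards to the right end point of the `j`-th
subinterval. The index `n + 1` stands for the final subinterval `[t_n, b]`, whose right end point
is the final time. -/
noncomputable def costate (y : H) (j : ℕ) : H :=
  if j ≤ Q.n then
    (1 + adjoint (Q.D j)) (ascProd Q.stepAdj (j + 1) Q.n (adjoint (Q.Sα (Q.b - Q.t Q.n)) y))
  else y

theorem costate_of_le (y : H) {j : ℕ} (hj : j ≤ Q.n) : Q.costate y j =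
    (1 + adjoint (Q.D j)) (ascProd Q.stepAdj (j + 1) Q.n (adjoint (Q.Sα (Q.b - Q.t Q.n)) y)) :=
  if_pos hj

theorem costate_last (y : H) : Q.costate y (Q.n + 1) = y := if_neg (by omega)

/-- The contribution of a distributed control on the `j`-th subinterval. -/
noncomputable def segmentControl (j : ℕ) (u : ℝ → U) : H :=
  ∫ s in Q.t (j - 1)..Q.t j, (Q.t j - s) ^ (Q.α - 1) • Q.Pα (Q.t j - s) (Q.B (u s))

/-- The contribution of the `j`-th subinterval to the controllability Gramian. -/
noncomputable def segmentGram (j : ℕ) (z : H) : H :=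
  ∫ s in Q.t (j - 1)..Q.t j, (Q.t j - s) ^ (2 * Q.α - 2) •
    Q.Pα (Q.t j - s) (Q.B (adjoint Q.B (adjoint (Q.Pα (Q.t j - s)) z)))

theorem gramΩ_eq (y : H) : Q.gramΩ y = Q.segmentGram (Q.n + 1) (Q.costate y (Q.n + 1)) := by
  rw [gramΩ, segmentGram, Q.t_last, costate_last]
  rfl

theorem gramΨ_eq (y : H) : Q.gramΨ y = Q.Sα (Q.b - Q.t Q.n) (∑ i ∈ Finset.Icc 1 Q.n,
    descProd Q.step Q.n (i + 1) ((1 + Q.D i) (Q.segmentGram i (Q.costate y i)))) := by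
  rw [gramΨ]
  congr 1
  refine Finset.sum_congr rfl fun i hi => ?_
  rw [costate_of_le _ _ (Finset.mem_Icc.1 hi).2, segmentGram]

theorem inner_distributed (y : H) (x : ℕ → H) :
    ⟪Q.Sα (Q.b - Q.t Q.n) (∑ i ∈ Finset.Icc 1 Q.n,
      descProd Q.step Q.n (i + 1) ((1 + Q.D i) (x i))), y⟫_ℝ =
    ∑ i ∈ Finset.Icc 1 Q.n, ⟪x i, Q.costate y i⟫_ℝ := by
  rw [map_sum, sum_inner]
  refine Finset.sum_congr rfl fun i hi => ?_
  rw [costate_of_le _ _ (Finset.mem_Icc.1 hi).2, ← adjoint_descProd_step, ← adjoint_one_add,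
    ContinuousLinearMap.adjoint_inner_right, ContinuousLinearMap.adjoint_inner_right,
    ContinuousLinearMap.adjoint_inner_right]

/-! ### Non-negativity of the four maps -/

section Times

variable {Q}

theorem t_le {i j : ℕ} (hij : i ≤ j) (hj : j ≤ Q.n + 1) : Q.t i ≤ Q.t j := by
  induction j, hij using Nat.le_induction with
  | base => exact le_rfl
  | succ k _ ih =>
    refine (ih (by omega)).trans ?_
    rcases Nat.lt_or_ge k Q.n with h | h
    · exact (Q.t_lt k h).le
    · have : k = Q.n := by omega
      rw [this, Q.t_last]
      exact Q.t_n_le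

theorem t_nonneg {j : ℕ} (hj : j ≤ Q.n + 1) : 0 ≤ Q.t j := by
  have := t_le (Q := Q) (Nat.zero_le j) hj
  rwa [Q.t_zero] at this

theorem t_le_b {j : ℕ} (hj : j ≤ Q.n + 1) : Q.t j ≤ Q.b := by
  rw [← Q.t_last]
  exact t_le hj le_rfl

end Times

theorem inner_segmentGram_integrand (τ : ℝ) (z : H) :
    ⟪Q.Pα τ (Q.B (adjoint Q.B (adjoint (Q.Pα τ) z))), z⟫_ℝ =
      ‖adjoint Q.B (adjoint (Q.Pα τ) z)‖ ^ 2 := by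
  rw [← ContinuousLinearMap.adjoint_inner_right, ← ContinuousLinearMap.adjoint_inner_right,
    real_inner_self_eq_norm_sq]

theorem inner_segmentGram_nonneg {j : ℕ} (hj : j ≤ Q.n + 1) (z : H) :
    0 ≤ ⟪Q.segmentGram j z, z⟫_ℝ := by
  rw [segmentGram]
  by_cases h : IntervalIntegrable (fun s => (Q.t j - s) ^ (2 * Q.α - 2) •
    Q.Pα (Q.t j - s) (Q.B (adjoint Q.B (adjoint (Q.Pα (Q.t j - s)) z)))) volume
    (Q.t (j - 1)) (Q.t j)
  · rw [real_inner_comm, ← innerSL_apply_apply ℝ, ← ContinuousLinearMap.intervalIntegral_comp_comm _ h]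
    refine intervalIntegral.integral_nonneg (t_le (Nat.sub_le j 1) hj) fun s hs => ?_
    rw [innerSL_apply_apply, real_inner_smul_right, real_inner_comm, inner_segmentGram_integrand]
    have : 0 ≤ Q.t j - s := by linarith [hs.2]
    positivity
  · rw [intervalIntegral.integral_undef h, inner_zero_left]

theorem isPositiveMap_gramΩ : IsPositiveMap Q.gramΩ := fun y => by
  have := Q.inner_segmentGram_nonneg le_rfl y
  rwa [gramΩ_eq, costate_last]

theorem isPositiveMap_gramΨ : IsPositiveMap Q.gramΨ := fun y => by
  rw [gramΨ_eq, inner_distributed]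
  exact Finset.sum_nonneg fun i hi =>
    Q.inner_segmentGram_nonneg (by have := (Finset.mem_Icc.1 hi).2; omega) _

theorem isPositiveMap_gramΩtilde : IsPositiveMap Q.gramΩtilde := fun y => by
  rw [gramΩtilde, ← ContinuousLinearMap.adjoint_inner_right,
    ← ContinuousLinearMap.adjoint_inner_right]
  exact real_inner_self_nonneg

theorem isPositiveMap_gramΨtilde : IsPositiveMap Q.gramΨtilde := fun y => by
  rw [gramΨtilde, ← ContinuousLinearMap.adjoint_inner_right, sum_inner]
  refine Finset.sum_nonneg fun i _ => ?_
  rw [← ContinuousLinearMap.adjoint_inner_right, adjoint_descProd_step,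
    ← ContinuousLinearMap.adjoint_inner_right]
  exact real_inner_self_nonneg

/-! ### Linearity of the control map on controls with convergent integrals -/

theorem controlMap_eq (c : Q.ControlL2 × (Fin Q.n → U)) : Q.controlMap c =
    Q.segmentControl (Q.n + 1) c.1
    + Q.Sα (Q.b - Q.t Q.n) (∑ i ∈ Finset.Icc 1 Q.n,
      descProd Q.step Q.n (i + 1) ((1 + Q.D i) (Q.segmentControl i c.1)))
    + Q.Sα (Q.b - Q.t Q.n) (∑ i ∈ Finset.Icc 2 Q.n,
      descProd Q.step Q.n i (Q.E (i - 1) (Q.impulse c.2 (i - 1))))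
    + Q.Sα (Q.b - Q.t Q.n) (Q.E Q.n (Q.impulse c.2 Q.n)) := by
  rw [controlMap, segmentControl, Q.t_last]
  rfl

theorem impulse_add (v w : Fin Q.n → U) (k : ℕ) :
    Q.impulse (v + w) k = Q.impulse v k + Q.impulse w k := by
  unfold impulse; split_ifs <;> simp

theorem impulse_smul (r : ℝ) (v : Fin Q.n → U) (k : ℕ) :
    Q.impulse (r • v) k = r • Q.impulse v k := by
  unfold impulse; split_ifs <;> simp

theorem impulse_zero (k : ℕ) : Q.impulse 0 k = 0 := by
  unfold impulse; split_ifs <;> simp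

/-- All integrals over subintervals in the control map converge for `u`. -/
def Admissible (u : ℝ → U) : Prop :=
  ∀ j ∈ Finset.Icc 1 (Q.n + 1), IntervalIntegrable
    (fun s => (Q.t j - s) ^ (Q.α - 1) • Q.Pα (Q.t j - s) (Q.B (u s))) volume
    (Q.t (j - 1)) (Q.t j)

theorem ae_uIoc_of_ae {p : ℝ → Prop} (h : ∀ᵐ s ∂volume.restrict (Set.Icc 0 Q.b), p s) {j : ℕ}
    (hj : j ≤ Q.n + 1) : ∀ᵐ s ∂volume.restrict (Set.uIoc (Q.t (j - 1)) (Q.t j)), p s := by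
  refine ae_restrict_of_ae_restrict_of_subset (fun s hs => ?_) h
  rw [Set.uIoc_of_le (t_le (Nat.sub_le j 1) hj)] at hs
  exact ⟨(t_nonneg (by omega)).trans hs.1.le, hs.2.trans (t_le_b hj)⟩

variable {Q}

theorem segmentControl_congr {u w : ℝ → U} (h : u =ᵐ[volume.restrict (Set.Icc 0 Q.b)] w) {j : ℕ}
    (hj : j ≤ Q.n + 1) : Q.segmentControl j u = Q.segmentControl j w := by
  refine intervalIntegral.integral_congr_ae_restrict ?_
  filter_upwards [Q.ae_uIoc_of_ae h hj] with s hs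
  rw [hs]

theorem Admissible.congr {u w : ℝ → U} (hu : Q.Admissible u)
    (h : u =ᵐ[volume.restrict (Set.Icc 0 Q.b)] w) : Q.Admissible w := fun j hj => by
  refine (hu j hj).congr_ae ?_
  filter_upwards [Q.ae_uIoc_of_ae h (Finset.mem_Icc.1 hj).2] with s hs
  rw [hs]

theorem Admissible.add {u w : ℝ → U} (hu : Q.Admissible u) (hw : Q.Admissible w) :
    Q.Admissible (u + w) := fun j hj => by
  simpa only [Pi.add_apply, map_add, smul_add] using (hu j hj).add (hw j hj)

theorem Admissible.smul {u : ℝ → U} (hu : Q.Admissible u) (r : ℝ) :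
    Q.Admissible (r • u) := fun j hj => by
  have := (hu j hj).smul r
  simp only [Pi.smul_apply, map_smul]
  simp only [Pi.smul_def, smul_comm r] at this
  exact this

theorem segmentControl_add {u w : ℝ → U} (hu : Q.Admissible u) (hw : Q.Admissible w) {j : ℕ}
    (hj : j ∈ Finset.Icc 1 (Q.n + 1)) :
    Q.segmentControl j (u + w) = Q.segmentControl j u + Q.segmentControl j w := by
  rw [segmentControl, segmentControl, segmentControl,
    ← intervalIntegral.integral_add (hu j hj) (hw j hj)]
  simp only [Pi.add_apply, map_add, smul_add]

theorem segmentControl_smul (r : ℝ) (u : ℝ → U) (j : ℕ) :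
    Q.segmentControl j (r • u) = r • Q.segmentControl j u := by
  rw [segmentControl, segmentControl, ← intervalIntegral.integral_smul]
  simp only [Pi.smul_apply, map_smul, smul_comm r]

theorem segmentControl_zero (j : ℕ) : Q.segmentControl j (0 : ℝ → U) = 0 := by
  simp [segmentControl]

theorem controlMap_add {c d : Q.ControlL2 × (Fin Q.n → U)} (hc : Q.Admissible c.1)
    (hd : Q.Admissible d.1) : Q.controlMap (c + d) = Q.controlMap c + Q.controlMap d := by
  have h : ∀ j ∈ Finset.Icc 1 (Q.n + 1), Q.segmentControl j (c + d).1 =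
      Q.segmentControl j c.1 + Q.segmentControl j d.1 := fun j hj => by
    rw [← segmentControl_add hc hd hj]
    exact segmentControl_congr (Lp.coeFn_add c.1 d.1) (Finset.mem_Icc.1 hj).2
  have h1 : ∀ i ∈ Finset.Icc 1 Q.n, descProd Q.step Q.n (i + 1)
      ((1 + Q.D i) (Q.segmentControl i (c + d).1)) =
      descProd Q.step Q.n (i + 1) ((1 + Q.D i) (Q.segmentControl i c.1)) +
        descProd Q.step Q.n (i + 1) ((1 + Q.D i) (Q.segmentControl i d.1)) := fun i hi => by
    rw [h i (Finset.Icc_subset_Icc_right (Nat.le_succ _) hi), map_add, map_add]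
  rw [controlMap_eq, controlMap_eq, controlMap_eq, Finset.sum_congr rfl h1,
    h _ (Finset.mem_Icc.2 ⟨by omega, le_rfl⟩)]
  simp only [Prod.snd_add, impulse_add, map_add, Finset.sum_add_distrib]
  abel

theorem controlMap_smul (r : ℝ) (c : Q.ControlL2 × (Fin Q.n → U)) :
    Q.controlMap (r • c) = r • Q.controlMap c := by
  have h : ∀ j ∈ Finset.Icc 1 (Q.n + 1), Q.segmentControl j (r • c).1 =
      r • Q.segmentControl j c.1 := fun j hj => by
    rw [← segmentControl_smul]
    exact segmentControl_congr (Lp.coeFn_smul r c.1) (Finset.mem_Icc.1 hj).2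
  have h1 : ∀ i ∈ Finset.Icc 1 Q.n, descProd Q.step Q.n (i + 1)
      ((1 + Q.D i) (Q.segmentControl i (r • c).1)) =
      r • descProd Q.step Q.n (i + 1) ((1 + Q.D i) (Q.segmentControl i c.1)) := fun i hi => by
    rw [h i (Finset.Icc_subset_Icc_right (Nat.le_succ _) hi), map_smul, map_smul]
  rw [controlMap_eq, controlMap_eq, Finset.sum_congr rfl h1,
    h _ (Finset.mem_Icc.2 ⟨by omega, le_rfl⟩)]
  simp only [Prod.smul_snd, impulse_smul, map_smul, ← Finset.smul_sum, smul_add]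

theorem admissible_zero : Q.Admissible (0 : ℝ → U) := fun j _ => by simp

variable (Q)

/-- The final states reached by admissible controls. For `α ≤ 1 / 2` the control map need not be
additive on all of `L²`, since divergent integrals are read as `0`; on admissible controls
it is. -/
def admissibleImage : Submodule ℝ H where
  carrier := {h | ∃ c : Q.ControlL2 × (Fin Q.n → U), Q.Admissible c.1 ∧ Q.controlMap c = h}
  zero_mem' := by
    refine ⟨0, admissible_zero.congr (Lp.coeFn_zero _ _ _).symm, ?_⟩
    have := Q.controlMap_smul 0 0
    rwa [zero_smul, zero_smul] at this
  add_mem' := by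
    rintro _ _ ⟨c, hc, rfl⟩ ⟨d, hd, rfl⟩
    exact ⟨c + d, (hc.add hd).congr (Lp.coeFn_add c.1 d.1).symm, controlMap_add hc hd⟩
  smul_mem' := by
    rintro r _ ⟨c, hc, rfl⟩
    exact ⟨r • c, (hc.smul r).congr (Lp.coeFn_smul r c.1).symm, controlMap_smul r c⟩

/-! ### States orthogonal to the reachable ones -/

/-- The impulsive Gramians are themselves values of the control map, at `v_k = E_k^* ⋯ y`. -/
theorem inner_tilde_eq_zero {y : H} (hy : y ∈ Q.admissibleImageᗮ) :
    ⟪Q.gramΩtilde y, y⟫_ℝ + ⟪Q.gramΨtilde y, y⟫_ℝ = 0 := by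
  let v : Fin Q.n → U := fun k => adjoint (Q.E (k + 1))
    (ascProd Q.stepAdj (k + 2) Q.n (adjoint (Q.Sα (Q.b - Q.t Q.n)) y))
  have hv : ∀ k, 1 ≤ k → k ≤ Q.n → Q.impulse v k = adjoint (Q.E k)
      (ascProd Q.stepAdj (k + 1) Q.n (adjoint (Q.Sα (Q.b - Q.t Q.n)) y)) := fun k h1 h2 => by
    obtain ⟨k, rfl⟩ := Nat.exists_eq_add_of_le' h1
    rw [impulse, dif_pos ⟨h1, h2⟩]
    rfl
  have hz : ∀ j ≤ Q.n + 1, Q.segmentControl j ((0 : Q.ControlL2) : ℝ → U) = 0 := fun j hj => by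
    rw [segmentControl_congr (Lp.coeFn_zero _ _ _) hj, segmentControl_zero]
  have hM : Q.controlMap (0, v) = Q.gramΨtilde y + Q.gramΩtilde y := by
    have h1 : ∑ i ∈ Finset.Icc 1 Q.n, descProd Q.step Q.n (i + 1)
        ((1 + Q.D i) (Q.segmentControl i ((0 : Q.ControlL2) : ℝ → U))) = 0 :=
      Finset.sum_eq_zero fun i hi => by
        rw [hz i (by have := (Finset.mem_Icc.1 hi).2; omega), map_zero, map_zero]
    rw [controlMap_eq, hz _ le_rfl, h1, map_zero, zero_add, zero_add, gramΨtilde, gramΩtilde]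
    congr 2
    · refine Finset.sum_congr rfl fun i hi => ?_
      obtain ⟨hi1, hi2⟩ := Finset.mem_Icc.1 hi
      rw [hv _ (by omega) (by omega), Nat.sub_add_cancel (by omega)]
    · rw [hv _ Q.one_le_n le_rfl]
      simp [ascProd]
  have := (Submodule.mem_orthogonal _ _).1 hy _
    ⟨(0, v), admissible_zero.congr (Lp.coeFn_zero _ _ _).symm, rfl⟩
  rw [hM, inner_add_left] at this
  linarith

theorem inner_controlMap_distributed (u : Q.ControlL2) (y : H) :
    ⟪Q.controlMap (u, 0), y⟫_ℝ =
      ∑ j ∈ Finset.Icc 1 (Q.n + 1), ⟪Q.segmentControl j u, Q.costate y j⟫_ℝ := by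
  rw [controlMap_eq]
  simp only [impulse_zero, map_zero, Finset.sum_const_zero, add_zero]
  rw [inner_add_left, inner_distributed, Finset.sum_Icc_succ_top (by omega), costate_last, add_comm]

theorem continuousOn_Pα (c : ℝ) (x : H) :
    ContinuousOn (fun s => Q.Pα (c - s) x) (Set.Iic c) :=
  (continuousOn_fracP_apply Q.S Q.α_pos Q.α_le_one x).comp (by fun_prop) fun s hs =>
    Set.mem_Ici.2 (sub_nonneg.2 hs)

/-- The observation of a covector `z` through `B^* 𝒫_α^*` vanishes on the `j`-th subinterval if `z`
is the costate of a vector orthogonal to all reachable states. This is tested with the control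
`s ↦ ⟪𝒫_α(t_j - s) B w, z⟫ w` on that subinterval, which stays bounded even when the Gramian
integral diverges. -/
theorem observation_eq_zero {y : H} (hy : y ∈ Q.admissibleImageᗮ) {j : ℕ}
    (hj : j ∈ Finset.Icc 1 (Q.n + 1)) {s : ℝ} (hs : s ∈ Set.Ioo (Q.t (j - 1)) (Q.t j)) :
    adjoint Q.B (adjoint (Q.Pα (Q.t j - s)) (Q.costate y j)) = 0 := by
  obtain ⟨hj1, hj2⟩ := Finset.mem_Icc.1 hj
  have hle : Q.t (j - 1) ≤ Q.t j := t_le (Nat.sub_le j 1) hj2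
  set z := Q.costate y j with hz
  refine ext_inner_left ℝ fun w => ?_
  rw [ContinuousLinearMap.adjoint_inner_right, ContinuousLinearMap.adjoint_inner_right,
    inner_zero_right]
  set f : ℝ → ℝ := fun s => ⟪Q.Pα (Q.t j - s) (Q.B w), z⟫_ℝ with hf
  have hfc : ContinuousOn f (Set.Iic (Q.t j)) := (Q.continuousOn_Pα _ _).inner continuousOn_const
  have hIcc : Set.Icc (Q.t (j - 1)) (Q.t j) ⊆ Set.Iic (Q.t j) := fun s hs => hs.2
  let g : ℝ → U := (Set.Ioc (Q.t (j - 1)) (Q.t j)).indicator fun s => f s • w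
  have hgmem : MemLp g 2 (volume.restrict (Set.Icc 0 Q.b)) := by
    obtain ⟨C, hC⟩ := isCompact_Icc.exists_bound_of_continuousOn (hfc.mono hIcc)
    have hfm : AEStronglyMeasurable (fun s => f s • w)
        (volume.restrict (Set.Ioc (Q.t (j - 1)) (Q.t j))) :=
      ((hfc.mono (Set.Ioc_subset_Icc_self.trans hIcc)).smul
        continuousOn_const).aestronglyMeasurable measurableSet_Ioc
    refine MemLp.of_bound ((aestronglyMeasurable_indicator_iff measurableSet_Ioc).2
      hfm).restrict (C * ‖w‖) (Eventually.of_forall fun s => ?_)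
    have hC0 : 0 ≤ C := (norm_nonneg _).trans (hC _ (Set.left_mem_Icc.2 hle))
    by_cases hs : s ∈ Set.Ioc (Q.t (j - 1)) (Q.t j)
    · rw [show g s = f s • w from Set.indicator_of_mem hs _, norm_smul]
      exact mul_le_mul_of_nonneg_right (hC s (Set.Ioc_subset_Icc_self hs)) (norm_nonneg _)
    · rw [show g s = 0 from Set.indicator_of_notMem hs _, norm_zero]
      positivity
  let u : Q.ControlL2 := hgmem.toLp g
  have hu : u =ᵐ[volume.restrict (Set.Icc 0 Q.b)] g := hgmem.coeFn_toLp
  -- the weight is integrable since `α > 0`, and the remaining factor is continuous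
  have hint : IntervalIntegrable (fun s => (Q.t j - s) ^ (Q.α - 1) •
      Q.Pα (Q.t j - s) (Q.B (f s • w))) volume (Q.t (j - 1)) (Q.t j) := by
    have hr : IntervalIntegrable (fun s : ℝ => (Q.t j - s) ^ (Q.α - 1)) volume
        (Q.t (j - 1)) (Q.t j) := by
      have := (intervalIntegral.intervalIntegrable_rpow' (a := Q.t j - Q.t (j - 1)) (b := 0)
        (r := Q.α - 1) (by linarith [Q.α_pos])).comp_sub_left (Q.t j)
      simpa using this
    refine hr.smul_continuousOn ?_
    rw [Set.uIcc_of_le hle]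
    simp only [map_smul]
    exact (hfc.mono hIcc).smul ((Q.continuousOn_Pα _ _).mono hIcc)
  have hgj : ∀ s ∈ Set.uIoc (Q.t (j - 1)) (Q.t j), g s = f s • w := fun s hs => by
    rw [Set.uIoc_of_le hle] at hs
    exact Set.indicator_of_mem hs _
  have hgi : ∀ i ∈ Finset.Icc 1 (Q.n + 1), i ≠ j → ∀ s ∈ Set.uIoc (Q.t (i - 1)) (Q.t i),
      g s = 0 := fun i hi hij s hs => by
    obtain ⟨hi1, hi2⟩ := Finset.mem_Icc.1 hi
    rw [Set.uIoc_of_le (t_le (Nat.sub_le i 1) hi2)] at hs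
    refine Set.indicator_of_notMem (fun hs' => ?_) _
    rcases Nat.lt_or_gt_of_ne hij with h | h
    · have := t_le (Q := Q) (i := i) (j := j - 1) (by omega) (by omega)
      linarith [hs.2, hs'.1]
    · have := t_le (Q := Q) (i := j) (j := i - 1) (by omega) (by omega)
      linarith [hs.1, hs'.2]
  have hadm : Q.Admissible u := by
    refine Admissible.congr (fun i hi => ?_) hu.symm
    by_cases hij : i = j
    · subst hij
      refine hint.congr fun s hs => ?_
      simp only [hgj s hs]
    · refine (intervalIntegrable_const (c := (0 : H))).congr fun s hs => ?_
      simp only [hgi i hi hij s hs, map_zero, smul_zero]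
  have horth : ⟪Q.segmentControl j u, z⟫_ℝ = 0 := by
    have h1 := (Submodule.mem_orthogonal _ _).1 hy _ ⟨(u, 0), hadm, rfl⟩
    rw [inner_controlMap_distributed, Finset.sum_eq_single_of_mem j hj] at h1
    · exact h1
    · intro i hi hij
      have : Q.segmentControl i g = 0 := by
        refine (intervalIntegral.integral_congr_ae (Eventually.of_forall fun s hs => ?_)).trans
          intervalIntegral.integral_zero
        rw [hgi i hi hij s hs, map_zero, map_zero, smul_zero]
      rw [segmentControl_congr hu (Finset.mem_Icc.1 hi).2, this, inner_zero_left]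
  have hzero : ∫ s in Q.t (j - 1)..Q.t j, (Q.t j - s) ^ (Q.α - 1) * f s ^ 2 = 0 := by
    have h1 : Q.segmentControl j u = ∫ s in Q.t (j - 1)..Q.t j, (Q.t j - s) ^ (Q.α - 1) •
        Q.Pα (Q.t j - s) (Q.B (f s • w)) := by
      rw [segmentControl_congr hu hj2, segmentControl]
      exact intervalIntegral.integral_congr_ae (Eventually.of_forall fun s hs => by
        rw [hgj s hs])
    rw [← horth, h1, real_inner_comm, ← innerSL_apply_apply ℝ,
      ← ContinuousLinearMap.intervalIntegral_comp_comm _ hint]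
    congr 1
    funext s
    rw [innerSL_apply_apply, map_smul, map_smul, real_inner_smul_right, real_inner_smul_right,
      real_inner_comm, sq]
  have hint2 : IntervalIntegrable (fun s => (Q.t j - s) ^ (Q.α - 1) * f s ^ 2) volume
      (Q.t (j - 1)) (Q.t j) := by
    have := (innerSL ℝ z).integrable_comp hint.1
    refine ((intervalIntegrable_iff_integrableOn_Ioc_of_le hle).2 this).congr fun s _ => ?_
    simp only [map_smul, smul_eq_mul, innerSL_apply_apply]
    rw [real_inner_comm, sq]
  have hae := (intervalIntegral.integral_eq_zero_iff_of_le_of_nonneg_ae hle (by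
    filter_upwards [ae_restrict_mem measurableSet_Ioc] with s hs
    have : 0 ≤ Q.t j - s := by linarith [hs.2]
    exact mul_nonneg (Real.rpow_nonneg this _) (sq_nonneg _)) hint2).1 hzero
  have hae' : f =ᵐ[volume.restrict (Set.Ioo (Q.t (j - 1)) (Q.t j))] 0 := by
    filter_upwards [ae_restrict_of_ae_restrict_of_subset Set.Ioo_subset_Ioc_self hae,
      ae_restrict_mem measurableSet_Ioo] with s hs hs'
    have hpos : 0 < (Q.t j - s) ^ (Q.α - 1) := Real.rpow_pos_of_pos (by linarith [hs'.2]) _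
    simpa [hpos.ne'] using hs
  exact Measure.eqOn_open_of_ae_eq hae' isOpen_Ioo
    (hfc.mono (Set.Ioo_subset_Icc_self.trans hIcc)) continuousOn_const hs

theorem segmentGram_eq_zero {y : H} (hy : y ∈ Q.admissibleImageᗮ) {j : ℕ}
    (hj : j ∈ Finset.Icc 1 (Q.n + 1)) : Q.segmentGram j (Q.costate y j) = 0 := by
  have hle : Q.t (j - 1) ≤ Q.t j := t_le (Nat.sub_le j 1) (Finset.mem_Icc.1 hj).2
  rw [segmentGram, intervalIntegral.integral_of_le hle, integral_Ioc_eq_integral_Ioo]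
  refine setIntegral_eq_zero_of_forall_eq_zero fun s hs => ?_
  rw [Q.observation_eq_zero hy hj hs, map_zero, map_zero, smul_zero]

theorem inner_sum_gram_eq_zero {y : H} (hy : y ∈ Q.admissibleImageᗮ) :
    ⟪Q.gramΩ y + Q.gramΨ y + Q.gramΩtilde y + Q.gramΨtilde y, y⟫_ℝ = 0 := by
  have h1 : Q.gramΩ y = 0 := by
    rw [gramΩ_eq]
    exact Q.segmentGram_eq_zero hy (Finset.mem_Icc.2 ⟨by omega, le_rfl⟩)
  have h2 : Q.gramΨ y = 0 := by
    rw [gramΨ_eq, Finset.sum_eq_zero fun i hi => ?_, map_zero]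
    rw [Q.segmentGram_eq_zero hy (Finset.Icc_subset_Icc_right (Nat.le_succ _) hi), map_zero,
      map_zero]
  rw [h1, h2, add_zero, zero_add, inner_add_left]
  exact Q.inner_tilde_eq_zero hy

theorem approximatelyControllable_of_isStrictlyPositiveMap
    (h : IsStrictlyPositiveMap
      (fun φ => Q.gramΩ φ + Q.gramΨ φ + Q.gramΩtilde φ + Q.gramΨtilde φ)) :
    Q.ApproximatelyControllable := by
  have hperp : Q.admissibleImageᗮ = ⊥ := by
    refine (Submodule.eq_bot_iff _).2 fun y hy => ?_
    by_contra hne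
    exact (h y hne).ne' (Q.inner_sum_gram_eq_zero hy)
  have hdense : closure (Q.admissibleImage : Set H) = Set.univ := by
    rw [← Submodule.topologicalClosure_coe, Submodule.topologicalClosure_eq_top_iff.2 hperp,
      Submodule.top_coe]
  refine Set.eq_univ_of_univ_subset (hdense.symm.subset.trans (closure_mono ?_))
  rintro _ ⟨c, -, rfl⟩
  exact ⟨c, rfl⟩

end System

end FracImpulsive

open FracImpulsive in
theorem mainTheorem7 {H U : Type*}
    [NormedAddCommGroup H] [InnerProductSpace ℝ H] [CompleteSpace H]
    [NormedAddCommGroup U] [InnerProductSpace ℝ U] [CompleteSpace U]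
    (Q : System H U) :
    (IsPositiveMap Q.gramΩ ∧ IsPositiveMap Q.gramΨ ∧
      IsPositiveMap Q.gramΩtilde ∧ IsPositiveMap Q.gramΨtilde) ∧
    ((IsStrictlyPositiveMap Q.gramΩ ∨ IsStrictlyPositiveMap Q.gramΨ ∨
        IsStrictlyPositiveMap Q.gramΩtilde ∨ IsStrictlyPositiveMap Q.gramΨtilde) →
      IsStrictlyPositiveMap
        (fun φ => Q.gramΩ φ + Q.gramΨ φ + Q.gramΩtilde φ + Q.gramΨtilde φ) ∧
      Q.ApproximatelyControllable) := by
  have h1 := Q.isPositiveMap_gramΩ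
  have h2 := Q.isPositiveMap_gramΨ
  have h3 := Q.isPositiveMap_gramΩtilde
  have h4 := Q.isPositiveMap_gramΨtilde
  refine ⟨⟨h1, h2, h3, h4⟩, fun h => ?_⟩
  have hpos : IsStrictlyPositiveMap
      (fun φ => Q.gramΩ φ + Q.gramΨ φ + Q.gramΩtilde φ + Q.gramΨtilde φ) := fun y hy => by
    have e1 := h1 y
    have e2 := h2 y
    have e3 := h3 y
    have e4 := h4 y
    rw [inner_add_left, inner_add_left, inner_add_left]
    rcases h with h | h | h | h <;> linarith [h y hy]
  exact ⟨hpos, Q.approximatelyControllable_of_isStrictlyPositiveMap hpos⟩
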